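/- Let $\mathcal H$ be a complex Hilbert space and let $H_s, W_s, \rho_s(0)$ be bounded linear operators on $\mathcal H$, with $H_s$ and $W_s$ self-adjoint; $\|\cdot\|$ is the operator norm. Let $B:\mathbb R^2\to\mathbb C$ satisfy $|B(\tau_1,\tau_2)|\le \bar B$ for all $\tau_1,\tau_2$, and suppose that at all points with $\tau_1\ne0$, $\tau_2\neq 0$ the partial derivatives of $B$ of first and second order exist, with $|\partial_{\tau_1}B|+|\partial_{\tau_2}B|\le \bar B'$ and with each of the four second-order partial derivatives bounded in absolute value by $\bar B''$. For real numbers $\tau_1\le\dots\le\tau_N$ put $$\mathcal L_b(\tau_1,\dots,\tau_N)=\sum_{\mathfrak q}\ \prod_{\{i<j\}\in\mathfrak q}B(\tau_i,\tau_j),$$ the sum being over all partitions $\mathfrak q$ of $\{1,\dots,N\}$ into pairs (so $\mathcal L_b=1$ for $N=0$ and $\mathcal L_b=0$ for odd $N$). For $t\ge 0$ let $$\rho_s(t)=\sum_{m,m'=0}^{\infty}(-\mathrm i)^m\,\mathrm i^{m'}\int_{0<t_1<\dots<t_m<t}\int_{0<t_1'<\dots<t'_{m'}<t}e^{-\mathrm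 iH_s(t-t_m)}W_s\cdots W_se^{-\mathrm iH_st_1}\,\rho_s(0)\,e^{\mathrm iH_st_1'}W_s\cdots W_se^{\mathrm iH_s(t-t'_{m'})}\ \mathcal L_b(-t_m,\dots,-t_1,t_1',\dots,t'_{m'})\,\mathrm dt'\,\mathrm dt .$$ For a time step $\Delta t>0$ let $$\mathcal P_0=e^{-\mathrm iH_s\Delta t},\quad \mathcal P_1=-\mathrm i\,\Delta t\,e^{-\mathrm iH_s\Delta t/2}W_se^{-\mathrm iH_s\Delta t/2},\quad \mathcal P_2=-\tfrac{\Delta t^2}{2}e^{-\mathrm iH_s\Delta t/2}W_s^2e^{-\mathrm iH_s\Delta t/2},$$ and define the second-order scheme $$\rho_{s,n}=\sum_{j_{1-},\dots,j_{n-},\,j_{1+},\dots,j_{n+}\in\{0,1,2\}}\mathcal P_{j_{n-}}\cdots\mathcal P_{j_{1-}}\,\rho_s(0)\,\mathcal P_{j_{1+}}^\dagger\cdots\mathcal P_{j_{n+}}^\dagger\ \mathcal L_b(\boldsymbol\tau_{\boldsymbol j}),$$ where $\boldsymbol\tau_{\boldsymbol j}$ is the increasing list in which each $-(k-\tfrac12)\Delta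 t$ occurs $j_{k-}$ times and each $(k-\tfrac12)\Delta t$ occurs $j_{k+}$ times, $k=1,\dots,n$. Then there is a constant $C$, depending only on $\|\rho_s(0)\|$, $\|W_s\|$, $\|H_s\|$, $\bar B$, $\bar B'$, $\bar B''$ and $T=n\Delta t$, such that all the integrals defining $\rho_s(n\Delta t)$ converge absolutely, the double series converges unconditionally in operator norm, and $$\|\rho_{s,n}-\rho_s(n\Delta t)\|\le C\,\Delta t^2 .$$ -/

import Mathlib

open MeasureTheory

noncomputable section

namespace OpenSystem

/-! ### The bath: correlation function and influence functional -/

/-- All pairings (perfect matchings) of `{0, …, N - 1}`, encoded as the involutions without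
fixed points: `i` is paired with `σ i`. -/
def pairings (N : ℕ) : Finset (Equiv.Perm (Fin N)) :=
  {σ | ∀ i, σ (σ i) = i ∧ σ i ≠ i}

/-- The bath influence functional of the ordered time points `τ 0, …, τ (N - 1)`: the sum over
all pairings of the product of `B (τ i) (τ j)` over the pairs `{i, j}`, `i < j`. It is `1` for
`N = 0` (empty pairing) and `0` for odd `N` (no pairing). -/
def bathInfluence (B : ℝ → ℝ → ℂ) {N : ℕ} (τ : Fin N → ℝ) : ℂ :=
  ∑ σ ∈ pairings N, ∏ i : Fin N with i < σ i, B (τ i) (τ (σ i))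

/-- `∂B/∂τ₁`. -/
def pderiv₁ (B : ℝ → ℝ → ℂ) (τ₁ τ₂ : ℝ) : ℂ := deriv (fun x => B x τ₂) τ₁

/-- `∂B/∂τ₂`. -/
def pderiv₂ (B : ℝ → ℝ → ℂ) (τ₁ τ₂ : ℝ) : ℂ := deriv (fun x => B τ₁ x) τ₂

/-- Both first-order partial derivatives of `B` exist at `(τ₁, τ₂)`. -/
def HasPartials (B : ℝ → ℝ → ℂ) (τ₁ τ₂ : ℝ) : Prop :=
  DifferentiableAt ℝ (fun x => B x τ₂) τ₁ ∧ DifferentiableAt ℝ (fun x => B τ₁ x) τ₂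

/-- The hypotheses on the bath correlation function: `B` is bounded by `b`; away from the axes
`τ₁ = 0` and `τ₂ = 0` its partial derivatives of first and second order exist, with
`|∂₁B| + |∂₂B| ≤ b'` and every second-order partial derivative bounded by `b''`.
The axes are left out because correlation functions of harmonic baths, which depend on
`|τ₁| - |τ₂|`, have kinks there. -/
structure BathBounds (B : ℝ → ℝ → ℂ) (b b' b'' : ℝ) : Prop where
  bound : ∀ τ₁ τ₂, ‖B τ₁ τ₂‖ ≤ b
  partials : ∀ τ₁ τ₂, τ₁ ≠ 0 → τ₂ ≠ 0 → HasPartials B τ₁ τ₂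
  bound' : ∀ τ₁ τ₂, τ₁ ≠ 0 → τ₂ ≠ 0 → ‖pderiv₁ B τ₁ τ₂‖ + ‖pderiv₂ B τ₁ τ₂‖ ≤ b'
  partials₁ : ∀ τ₁ τ₂, τ₁ ≠ 0 → τ₂ ≠ 0 → HasPartials (pderiv₁ B) τ₁ τ₂
  partials₂ : ∀ τ₁ τ₂, τ₁ ≠ 0 → τ₂ ≠ 0 → HasPartials (pderiv₂ B) τ₁ τ₂
  bound₁₁ : ∀ τ₁ τ₂, τ₁ ≠ 0 → τ₂ ≠ 0 → ‖pderiv₁ (pderiv₁ B) τ₁ τ₂‖ ≤ b''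
  bound₂₁ : ∀ τ₁ τ₂, τ₁ ≠ 0 → τ₂ ≠ 0 → ‖pderiv₂ (pderiv₁ B) τ₁ τ₂‖ ≤ b''
  bound₁₂ : ∀ τ₁ τ₂, τ₁ ≠ 0 → τ₂ ≠ 0 → ‖pderiv₁ (pderiv₂ B) τ₁ τ₂‖ ≤ b''
  bound₂₂ : ∀ τ₁ τ₂, τ₁ ≠ 0 → τ₂ ≠ 0 → ‖pderiv₂ (pderiv₂ B) τ₁ τ₂‖ ≤ b''

/-! ### The exact reduced density matrix (Dyson series) -/

section System

variable {E : Type*} [NormedAddCommGroup E] [InnerProductSpace ℂ E] [CompleteSpace E]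

/-- The free propagator `exp (-i t Hs)`. -/
def freeProp (Hs : E →L[ℂ] E) (t : ℝ) : E →L[ℂ] E :=
  NormedSpace.exp ((-Complex.I * (t : ℂ)) • Hs)

/-- `e^{-i Hs (t - t_m)} Ws e^{-i Hs (t_m - t_{m-1})} Ws ⋯ Ws e^{-i Hs t_1}`,
where `t_k = s (k - 1)`. -/
def leftDyson (Hs Ws : E →L[ℂ] E) : (m : ℕ) → (Fin m → ℝ) → ℝ → (E →L[ℂ] E)
  | 0, _, t => freeProp Hs t
  | m + 1, s, t =>
      freeProp Hs (t - s (Fin.last m)) * Ws * leftDyson Hs Ws m (Fin.init s) (s (Fin.last m))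

/-- `e^{i Hs t_1} Ws e^{i Hs (t_2 - t_1)} Ws ⋯ Ws e^{i Hs (t - t_m)}`,
where `t_k = s (k - 1)`. -/
def rightDyson (Hs Ws : E →L[ℂ] E) : (m : ℕ) → (Fin m → ℝ) → ℝ → (E →L[ℂ] E)
  | 0, _, t => freeProp Hs (-t)
  | m + 1, s, t =>
      rightDyson Hs Ws m (Fin.init s) (s (Fin.last m)) * Ws * freeProp Hs (-(t - s (Fin.last m)))

/-- The simplex `0 < t_1 < ⋯ < t_m < t`. -/
def simplex (m : ℕ) (t : ℝ) : Set (Fin m → ℝ) :=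
  {s | StrictMono s ∧ ∀ i, 0 < s i ∧ s i < t}

/-- The integrand of the `(m, m')` term of the Dyson series of the reduced density matrix, at the
point `(t_1, …, t_m; t'_1, …, t'_{m'})`. The arguments of the influence functional are
`-t_m, …, -t_1, t'_1, …, t'_{m'}`, in this order. -/
def dysonIntegrand (Hs Ws ρ₀ : E →L[ℂ] E) (B : ℝ → ℝ → ℂ) (t : ℝ) (m m' : ℕ)
    (s : (Fin m → ℝ) × (Fin m' → ℝ)) : E →L[ℂ] E :=
  ((-Complex.I) ^ m * Complex.I ^ m' *
      bathInfluence B (Fin.append (fun i => -s.1 (Fin.rev i)) s.2)) •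
    (leftDyson Hs Ws m s.1 t * ρ₀ * rightDyson Hs Ws m' s.2 t)

/-- The `(m, m')` term of the Dyson series of the reduced density matrix. -/
def dysonTerm (Hs Ws ρ₀ : E →L[ℂ] E) (B : ℝ → ℝ → ℂ) (t : ℝ) (p : ℕ × ℕ) : E →L[ℂ] E :=
  ∫ s in simplex p.1 t ×ˢ simplex p.2 t, dysonIntegrand Hs Ws ρ₀ B t p.1 p.2 s

/-- The reduced density matrix `ρ_s(t)`, the sum of its Dyson series. -/
def reducedDensity (Hs Ws ρ₀ : E →L[ℂ] E) (B : ℝ → ℝ → ℂ) (t : ℝ) : E →L[ℂ] E :=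
  ∑' p : ℕ × ℕ, dysonTerm Hs Ws ρ₀ B t p

/-! ### The second-order scheme -/

/-- The one-step operators `P_{s,0}`, `P_{s,1}`, `P_{s,2}` for the time step `δ`. -/
def stepOp (Hs Ws : E →L[ℂ] E) (δ : ℝ) : Fin 3 → (E →L[ℂ] E)
  | 0 => freeProp Hs δ
  | 1 => (-Complex.I * (δ : ℂ)) • (freeProp Hs (δ / 2) * Ws * freeProp Hs (δ / 2))
  | 2 => (-((δ : ℂ) ^ 2 / 2)) • (freeProp Hs (δ / 2) * Ws ^ 2 * freeProp Hs (δ / 2))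

/-- The time points of the discrete influence functional, in increasing order: for `k = n, …, 1`
the midpoint `-(k - 1/2) δ` repeated `j_{k-}` times, then for `k = 1, …, n` the midpoint
`(k - 1/2) δ` repeated `j_{k+}` times. Here `j_{k∓}` is `jm (k - 1)`, `jp (k - 1)`. -/
def midpoints (δ : ℝ) {n : ℕ} (jm jp : Fin n → Fin 3) : List ℝ :=
  (List.ofFn fun k : Fin n =>
      List.replicate (jm k : ℕ) (-(((k : ℕ) : ℝ) + 1 / 2) * δ)).reverse.flatten ++
    (List.ofFn fun k : Fin n =>
      List.replicate (jp k : ℕ) ((((k : ℕ) : ℝ) + 1 / 2) * δ)).flatten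

/-- The second-order scheme `ρ_{s,n}` with time step `δ`: the sum over all
`j_{1-}, …, j_{n-}, j_{1+}, …, j_{n+} ∈ {0, 1, 2}` of
`P_{j_{n-}} ⋯ P_{j_{1-}} ρ₀ P_{j_{1+}}† ⋯ P_{j_{n+}}†` times the influence functional. -/
def secondOrderScheme (Hs Ws ρ₀ : E →L[ℂ] E) (B : ℝ → ℝ → ℂ) (δ : ℝ) (n : ℕ) : E →L[ℂ] E :=
  ∑ jm : Fin n → Fin 3, ∑ jp : Fin n → Fin 3,
    bathInfluence B (midpoints δ jm jp).get •
      ((List.ofFn fun k => stepOp Hs Ws δ (jm k)).reverse.prod * ρ₀ *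
        (List.ofFn fun k => star (stepOp Hs Ws δ (jp k))).prod)

end System

end OpenSystem

end

/-! In the interaction picture the `(m, m')` Dyson term is, up to conjugation by the free
propagator, the integral of `kernel` over a product of two simplices. Symmetrizing each group of
variables turns it into `1 / (m! m'!)` times an integral over a cube of side `T = n δ`, which is cut
into cells of side `δ`. The number of ways to place `m` labelled points in `n` time intervals with
occupation numbers `j` is a multinomial coefficient, so the weight `∏ δ ^ j_k / j_k!` of the scheme
counts exactly these placements. Hence the scheme is the midpoint rule on the cubes, except that
cells with three or more points of one branch in one time interval are left out
(`secondOrderScheme_eq_sum`).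

The error splits by type of cell (`norm_integral_box_sub_ite_le`). If no two points of a branch
share an interval, the sorting permutations are constant on the cell; averaging over the reflection
in the midpoint cancels the linear term and leaves an error of relative size `d ^ 2`, with `d` of
order `δ`. If two points share an interval, sorting creates a crease and the error is only of order
`d`, but such cells are a fraction `O(1 / n)` of all. Cells with three or more points in an interval
cost `O(1)` each, but are a fraction `O(1 / n ^ 2)`. As `1 / n = δ / T`, each contribution is `O(δ ^
2)`. Kinks of `B` on the axes do no harm, because no cell crosses them.

The regularity of `B` and of the interaction-picture coupling passes to the kernel through
`SecondDiffBound`: in products the bounds multiply and the rates add, so `d` grows only linearly in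
`m + m'`. Polynomial factors in `m`, `m'` are absorbed in `8 ^ (m + m')`. There are at most `√((m +
m')!)` pairings (`pairings_card_sq_le`), too few to outweigh `1 / (m! m'!)`, so everything sums
(`summable_majorant`). -/

namespace OpenSystem

/-! ### Bounds on values, differences and second differences -/

/-- `y` and `z` are values at two opposite displacements from the point where the value is `x`: all
three values are bounded by `a`, the differences by `a * d` and the second difference by
`a * d ^ 2`. -/
structure SecondDiffBound {X : Type*} [NormedAddCommGroup X] (x y z : X) (a d : ℝ) : Prop where
  norm_mid : ‖x‖ ≤ a
  norm_fst : ‖y‖ ≤ a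
  norm_snd : ‖z‖ ≤ a
  diff_fst : ‖y - x‖ ≤ a * d
  diff_snd : ‖z - x‖ ≤ a * d
  second_diff : ‖y + z - (x + x)‖ ≤ a * d ^ 2

namespace SecondDiffBound

section

variable {X : Type*} [NormedAddCommGroup X] {x y z : X} {a d : ℝ}

theorem nonneg (h : SecondDiffBound x y z a d) : 0 ≤ a := (norm_nonneg x).trans h.norm_mid

theorem mono {a' d' : ℝ} (h : SecondDiffBound x y z a d) (hd : 0 ≤ d) (ha : a ≤ a')
    (hd' : d ≤ d') : SecondDiffBound x y z a' d' := by
  have h0 := h.nonneg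
  have h1 : a * d ≤ a' * d' := by gcongr; exact h0.trans ha
  have h2 : a * d ^ 2 ≤ a' * d' ^ 2 := by gcongr; exact h0.trans ha
  exact ⟨h.norm_mid.trans ha, h.norm_fst.trans ha, h.norm_snd.trans ha, h.diff_fst.trans h1,
    h.diff_snd.trans h1, h.second_diff.trans h2⟩

theorem const (h : ‖x‖ ≤ a) (hd : 0 ≤ d) : SecondDiffBound x x x a d := by
  have h0 : 0 ≤ a := (norm_nonneg x).trans h
  refine ⟨h, h, h, ?_, ?_, ?_⟩ <;> simp <;> positivity

theorem sum {ι : Type*} (s : Finset ι) {x y z : ι → X}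
    (h : ∀ i ∈ s, SecondDiffBound (x i) (y i) (z i) a d) :
    SecondDiffBound (∑ i ∈ s, x i) (∑ i ∈ s, y i) (∑ i ∈ s, z i) (s.card * a) d := by
  have key : ∀ (f : ι → X) (C : ℝ), (∀ i ∈ s, ‖f i‖ ≤ C) → ‖∑ i ∈ s, f i‖ ≤ s.card * C := by
    intro f C hf
    simpa using norm_sum_le_of_le s hf
  refine ⟨key _ _ fun i hi => (h i hi).norm_mid, key _ _ fun i hi => (h i hi).norm_fst,
    key _ _ fun i hi => (h i hi).norm_snd, ?_, ?_, ?_⟩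
  · rw [← Finset.sum_sub_distrib, mul_assoc]
    exact key _ _ fun i hi => (h i hi).diff_fst
  · rw [← Finset.sum_sub_distrib, mul_assoc]
    exact key _ _ fun i hi => (h i hi).diff_snd
  · rw [← Finset.sum_add_distrib, ← Finset.sum_add_distrib, ← Finset.sum_sub_distrib, mul_assoc]
    exact key _ _ fun i hi => (h i hi).second_diff

theorem conj [StarAddMonoid X] [NormedStarGroup X] (h : SecondDiffBound x y z a d) :
    SecondDiffBound (star x) (star y) (star z) a d := by
  refine ⟨?_, ?_, ?_, ?_, ?_, ?_⟩ <;> simp only [← star_sub, ← star_add, norm_star]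
  exacts [h.norm_mid, h.norm_fst, h.norm_snd, h.diff_fst, h.diff_snd, h.second_diff]

/-- A discrete Leibniz rule. The rates add because the four pieces of the second difference are
bounded by `b e² a`, `b a d²` and twice `(b e)(a d)`, with sum exactly `b a (e + d)²`. -/
theorem smul {R : Type*} [NormedRing R] [Module R X] [IsBoundedSMul R X] {r s t : R} {b e : ℝ}
    (hr : SecondDiffBound r s t b e) (hx : SecondDiffBound x y z a d) :
    SecondDiffBound (r • x) (s • y) (t • z) (b * a) (e + d) := by
  have hb := hr.nonneg
  have ha := hx.nonneg
  have key : ∀ (u : R) (v : X) (p q : ℝ), ‖u‖ ≤ p → ‖v‖ ≤ q → ‖u • v‖ ≤ p * q := by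
    intro u v p q hu hv
    exact (norm_smul_le u v).trans
      (mul_le_mul hu hv (norm_nonneg _) ((norm_nonneg _).trans hu))
  refine ⟨key _ _ _ _ hr.norm_mid hx.norm_mid, key _ _ _ _ hr.norm_fst hx.norm_fst,
    key _ _ _ _ hr.norm_snd hx.norm_snd, ?_, ?_, ?_⟩
  · have : s • y - r • x = (s - r) • y + r • (y - x) := by
      rw [sub_smul, smul_sub]; abel
    rw [this]
    refine (norm_add_le_of_le (key _ _ _ _ hr.diff_fst hx.norm_fst)
      (key _ _ _ _ hr.norm_mid hx.diff_fst)).trans (le_of_eq ?_)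
    ring
  · have : t • z - r • x = (t - r) • z + r • (z - x) := by
      rw [sub_smul, smul_sub]; abel
    rw [this]
    refine (norm_add_le_of_le (key _ _ _ _ hr.diff_snd hx.norm_snd)
      (key _ _ _ _ hr.norm_mid hx.diff_snd)).trans (le_of_eq ?_)
    ring
  · have : s • y + t • z - (r • x + r • x) = (s + t - (r + r)) • x + r • (y + z - (x + x)) +
        ((s - r) • (y - x) + (t - r) • (z - x)) := by
      simp only [sub_smul, smul_sub, add_smul, smul_add]; abel
    rw [this]
    refine (norm_add_le_of_le (norm_add_le_of_le (key _ _ _ _ hr.second_diff hx.norm_mid)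
      (key _ _ _ _ hr.norm_mid hx.second_diff))
      (norm_add_le_of_le (key _ _ _ _ hr.diff_fst hx.diff_fst)
      (key _ _ _ _ hr.diff_snd hx.diff_snd))).trans (le_of_eq ?_)
    ring

end

section

variable {R : Type*} [NormedRing R] {x y z : R} {a d : ℝ}

theorem mul {r s t : R} {b e : ℝ} (hr : SecondDiffBound r s t b e)
    (hx : SecondDiffBound x y z a d) :
    SecondDiffBound (r * x) (s * y) (t * z) (b * a) (e + d) :=
  hr.smul hx

/-- The hypothesis `‖1‖ ≤ 1` replaces `NormOneClass`, which fails for operators on the zero space.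
-/
theorem list_prod_reverse {m : ℕ} {x y z : Fin m → R} (h1 : ‖(1 : R)‖ ≤ 1)
    (h : ∀ i, SecondDiffBound (x i) (y i) (z i) a d) :
    SecondDiffBound (List.ofFn x).reverse.prod (List.ofFn y).reverse.prod
      (List.ofFn z).reverse.prod (a ^ m) (m * d) := by
  induction m with
  | zero => simpa using const (x := (1 : R)) (a := 1) (d := 0) h1 le_rfl
  | succ m ih =>
    simp only [List.ofFn_succ', List.concat_eq_append, List.reverse_append, List.reverse_singleton,
      List.singleton_append, List.prod_cons]
    have h1 := (h (Fin.last m)).mul (ih fun i => h i.castSucc)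
    convert h1 using 1
    · ring
    · push_cast; ring

end

theorem prod {R : Type*} [NormedCommRing R] [NormOneClass R] {a d : ℝ} {ι : Type*} (s : Finset ι)
    {x y z : ι → R} (h : ∀ i ∈ s, SecondDiffBound (x i) (y i) (z i) a d) :
    SecondDiffBound (∏ i ∈ s, x i) (∏ i ∈ s, y i) (∏ i ∈ s, z i) (a ^ s.card) (s.card * d) := by
  classical
  induction s using Finset.induction_on with
  | empty => simpa using const (x := (1 : R)) (a := 1) (d := 0) (by simp) le_rfl
  | insert i s hi ih =>
    simp only [Finset.prod_insert hi, Finset.card_insert_of_notMem hi]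
    have h1 := (h i (by simp)).mul (ih fun j hj => h j (by simp [hj]))
    convert h1 using 1
    · ring
    · push_cast; ring

end SecondDiffBound

/-! ### Taylor estimates on the line -/

section Taylor

variable {X : Type*} [NormedAddCommGroup X] [NormedSpace ℝ X]

theorem norm_sub_le_of_hasDerivAt {g g' : ℝ → X} {x y C : ℝ}
    (hg : ∀ z ∈ Set.uIcc x y, HasDerivAt g (g' z) z) (hC : ∀ z ∈ Set.uIcc x y, ‖g' z‖ ≤ C) :
    ‖g y - g x‖ ≤ C * |y - x| := by
  simpa [Real.norm_eq_abs] using (convex_uIcc x y).norm_image_sub_le_of_norm_hasDerivWithin_le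
    (fun z hz => (hg z hz).hasDerivWithinAt) hC Set.left_mem_uIcc Set.right_mem_uIcc

/-- The mean value inequality applied to `g` minus its tangent at `x`. Only Lipschitz control of
`g'` from the base point is needed, at the price of the factor `1 / 2`. -/
theorem norm_sub_sub_le_of_hasDerivAt {g g' : ℝ → X} {x y C : ℝ}
    (hg : ∀ z ∈ Set.uIcc x y, HasDerivAt g (g' z) z)
    (hC : ∀ z ∈ Set.uIcc x y, ‖g' z - g' x‖ ≤ C * |z - x|) (hC0 : 0 ≤ C) :
    ‖g y - g x - (y - x) • g' x‖ ≤ C * |y - x| ^ 2 := by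
  have h1 : ∀ z ∈ Set.uIcc x y,
      HasDerivAt (fun z => g z - (z - x) • g' x) (g' z - (1 : ℝ) • g' x) z := by
    intro z hz
    exact (hg z hz).sub (((hasDerivAt_id z).sub_const x).smul_const (g' x))
  have h2 := norm_sub_le_of_hasDerivAt h1 (C := C * |y - x|) (by
    intro z hz
    rw [one_smul]
    refine (hC z hz).trans ?_
    exact mul_le_mul_of_nonneg_left (Set.abs_sub_left_of_mem_uIcc hz) hC0)
  simp only [sub_self, zero_smul, sub_zero] at h2
  calc _ = ‖g y - (y - x) • g' x - g x‖ := by congr 1; abel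
    _ ≤ _ := h2
    _ = _ := by ring

end Taylor

/-! ### The number of pairings -/

theorem cycleType_of_mem_pairings {N : ℕ} {σ : Equiv.Perm (Fin N)} (hσ : σ ∈ pairings N) :
    ∃ k, N = 2 * k ∧ σ.cycleType = Multiset.replicate k 2 := by
  simp only [pairings, Finset.mem_filter, Finset.mem_univ, true_and] at hσ
  have h2 : σ ^ 2 = 1 := by
    ext i
    simp [pow_two, (hσ i).1]
  have hr : ∀ a ∈ σ.cycleType, a = 2 := fun a ha =>
    le_antisymm (Nat.le_of_dvd two_pos
      ((Equiv.Perm.dvd_of_mem_cycleType ha).trans (orderOf_dvd_of_pow_eq_one h2)))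
      (Equiv.Perm.two_le_of_mem_cycleType ha)
  have hc := Multiset.eq_replicate_card.2 hr
  refine ⟨_, ?_, hc⟩
  have hs := σ.sum_cycleType
  have hu : σ.support = Finset.univ := by
    ext i
    simp [(hσ i).2]
  rw [hc, hu] at hs
  simp only [Multiset.sum_replicate, smul_eq_mul, Finset.card_univ, Fintype.card_fin] at hs
  omega

/-- For `N = 2k` there are at most `c = (2k)! / (2 ^ k k!)` pairings, and `(2k)! ≤ 4 ^ k (k!)²`
because the central binomial coefficient is at most `4 ^ k`; hence `c² ≤ (2k)!`. -/
theorem pairings_card_sq_le (N : ℕ) : ((pairings N).card : ℝ) ^ 2 ≤ (N.factorial : ℝ) := by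
  rcases (pairings N).eq_empty_or_nonempty with h0 | ⟨σ, hσ⟩
  · simp [h0]
  obtain ⟨k, rfl, -⟩ := cycleType_of_mem_pairings hσ
  have hsub : pairings (2 * k) ⊆
      ({g | g.cycleType = Multiset.replicate k 2} : Finset (Equiv.Perm (Fin (2 * k)))) := by
    intro τ hτ
    obtain ⟨l, hl, hτl⟩ := cycleType_of_mem_pairings hτ
    obtain rfl : k = l := by omega
    simpa using hτl
  have hcard := Equiv.Perm.card_of_cycleType_mul_eq (Fin (2 * k)) (Multiset.replicate k 2)
  have hle := Finset.card_le_card hsub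
  set c := (({g | g.cycleType = Multiset.replicate k 2} :
    Finset (Equiv.Perm (Fin (2 * k))))).card
  have hc : c * (2 ^ k * k.factorial) = (2 * k).factorial := by
    -- The case `k = 0` is separate: the cycle type is then empty and its `toFinset` is not `{2}`.
    rcases Nat.eq_zero_or_pos k with rfl | hk
    · simpa using hcard
    · have ht : (Multiset.replicate k 2).toFinset = {2} := by
        rw [Multiset.toFinset_replicate, if_neg hk.ne']
      have hm : k * 2 = 2 * k := mul_comm _ _
      have ha : ∀ a ∈ Multiset.replicate k 2, 2 ≤ a := fun a ha =>
        (Multiset.eq_of_mem_replicate ha).ge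
      rw [if_pos ⟨by simp [hm], ha⟩] at hcard
      simpa [ht, hm] using hcard
  have hb : (2 * k).factorial ≤ 4 ^ k * (k.factorial * k.factorial) := by
    have h1 := Nat.choose_mul_factorial_mul_factorial (show k ≤ 2 * k by omega)
    have h3 : (2 * k).choose k ≤ 4 ^ k := by
      calc _ ≤ 2 ^ (2 * k) := Nat.choose_le_two_pow _ _
        _ = 4 ^ k := by rw [pow_mul]; norm_num
    rw [show 2 * k - k = k by omega, mul_assoc] at h1
    rw [← h1]
    exact Nat.mul_le_mul_right _ h3
  have hfin : c ^ 2 ≤ (2 * k).factorial := by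
    have hpos : 0 < 4 ^ k * (k.factorial * k.factorial) := by positivity
    refine Nat.le_of_mul_le_mul_right ?_ hpos
    calc c ^ 2 * (4 ^ k * (k.factorial * k.factorial))
        = (c * (2 ^ k * k.factorial)) * (c * (2 ^ k * k.factorial)) := by
          rw [show (4 : ℕ) = 2 * 2 by norm_num, mul_pow]; ring
      _ = (2 * k).factorial * (2 * k).factorial := by rw [hc]
      _ ≤ _ := Nat.mul_le_mul_left _ hb
  exact_mod_cast (Nat.pow_le_pow_left hle 2).trans hfin

/-! ### Regularity of the bath correlation function -/

/-- `y` is displaced from `x` by at most `δ` in each coordinate, without crossing `0`, and `z` is the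
reflection of `y` in `x`. -/
def Reflects {ι : Type*} (δ : ℝ) (x y z : ι → ℝ) : Prop :=
  ∀ i, |y i - x i| ≤ δ ∧ |y i - x i| < |x i| ∧ z i = 2 * x i - y i

theorem Reflects.comp {ι κ : Type*} {δ : ℝ} {x y z : ι → ℝ} (h : Reflects δ x y z) (f : κ → ι) :
    Reflects δ (x ∘ f) (y ∘ f) (z ∘ f) := fun i => h (f i)

theorem ne_zero_of_mem_uIcc {x y z : ℝ} (hz : z ∈ Set.uIcc x y) (h : |y - x| < |x|) : z ≠ 0 := by
  have h1 := Set.abs_sub_left_of_mem_uIcc hz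
  rintro rfl
  rw [zero_sub, abs_neg] at h1
  linarith

section Bath

variable {B : ℝ → ℝ → ℂ} {b b' b'' : ℝ}

theorem BathBounds.nonneg (hB : BathBounds B b b' b'') : 0 ≤ b :=
  (norm_nonneg _).trans (hB.bound 0 0)

theorem BathBounds.nonneg' (hB : BathBounds B b b' b'') : 0 ≤ b' :=
  (add_nonneg (norm_nonneg _) (norm_nonneg _)).trans (hB.bound' 1 1 one_ne_zero one_ne_zero)

theorem BathBounds.nonneg'' (hB : BathBounds B b b' b'') : 0 ≤ b'' :=
  (norm_nonneg _).trans (hB.bound₁₁ 1 1 one_ne_zero one_ne_zero)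

theorem BathBounds.norm_sub_le₁ (hB : BathBounds B b b' b'') {x x' y : ℝ} (hx : |x' - x| < |x|)
    (hy : y ≠ 0) : ‖B x' y - B x y‖ ≤ b' * |x' - x| :=
  norm_sub_le_of_hasDerivAt (g := fun x => B x y) (g' := fun x => pderiv₁ B x y)
    (fun z hz => (hB.partials z y (ne_zero_of_mem_uIcc hz hx) hy).1.hasDerivAt)
    fun z hz => (le_add_of_nonneg_right (norm_nonneg _)).trans
      (hB.bound' z y (ne_zero_of_mem_uIcc hz hx) hy)

theorem BathBounds.norm_sub_le₂ (hB : BathBounds B b b' b'') {x y y' : ℝ} (hy : |y' - y| < |y|)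
    (hx : x ≠ 0) : ‖B x y' - B x y‖ ≤ b' * |y' - y| :=
  norm_sub_le_of_hasDerivAt (g := fun y => B x y) (g' := fun y => pderiv₂ B x y)
    (fun z hz => (hB.partials x z hx (ne_zero_of_mem_uIcc hz hy)).2.hasDerivAt)
    fun z hz => (le_add_of_nonneg_left (norm_nonneg _)).trans
      (hB.bound' x z hx (ne_zero_of_mem_uIcc hz hy))

theorem BathBounds.norm_pderiv₁_sub_le₂ (hB : BathBounds B b b' b'') {x y y' : ℝ}
    (hy : |y' - y| < |y|) (hx : x ≠ 0) :
    ‖pderiv₁ B x y' - pderiv₁ B x y‖ ≤ b'' * |y' - y| :=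
  norm_sub_le_of_hasDerivAt (g := fun y => pderiv₁ B x y)
    (g' := fun y => pderiv₂ (pderiv₁ B) x y)
    (fun z hz => (hB.partials₁ x z hx (ne_zero_of_mem_uIcc hz hy)).2.hasDerivAt)
    fun z hz => hB.bound₂₁ x z hx (ne_zero_of_mem_uIcc hz hy)

theorem BathBounds.taylor₁ (hB : BathBounds B b b' b'') {x x' y : ℝ} (hx : |x' - x| < |x|)
    (hy : y ≠ 0) : ‖B x' y - B x y - (x' - x) • pderiv₁ B x y‖ ≤ b'' * |x' - x| ^ 2 :=
  norm_sub_sub_le_of_hasDerivAt (g := fun x => B x y) (g' := fun x => pderiv₁ B x y)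
    (fun z hz => (hB.partials z y (ne_zero_of_mem_uIcc hz hx) hy).1.hasDerivAt)
    (fun _ hz => norm_sub_le_of_hasDerivAt (g := fun x => pderiv₁ B x y)
      (g' := fun x => pderiv₁ (pderiv₁ B) x y)
      (fun v hv => (hB.partials₁ v y
        (ne_zero_of_mem_uIcc (Set.uIcc_subset_uIcc_left hz hv) hx) hy).1.hasDerivAt)
      fun v hv => hB.bound₁₁ v y (ne_zero_of_mem_uIcc (Set.uIcc_subset_uIcc_left hz hv) hx) hy)
    hB.nonneg''

theorem BathBounds.taylor₂ (hB : BathBounds B b b' b'') {x y y' : ℝ} (hy : |y' - y| < |y|)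
    (hx : x ≠ 0) : ‖B x y' - B x y - (y' - y) • pderiv₂ B x y‖ ≤ b'' * |y' - y| ^ 2 :=
  norm_sub_sub_le_of_hasDerivAt (g := fun y => B x y) (g' := fun y => pderiv₂ B x y)
    (fun z hz => (hB.partials x z hx (ne_zero_of_mem_uIcc hz hy)).2.hasDerivAt)
    (fun _ hz => norm_sub_le_of_hasDerivAt (g := fun y => pderiv₂ B x y)
      (g' := fun y => pderiv₂ (pderiv₂ B) x y)
      (fun v hv => (hB.partials₂ x v hx
        (ne_zero_of_mem_uIcc (Set.uIcc_subset_uIcc_left hz hv) hy)).2.hasDerivAt)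
      fun v hv => hB.bound₂₂ x v hx (ne_zero_of_mem_uIcc (Set.uIcc_subset_uIcc_left hz hv) hy))
    hB.nonneg''

theorem BathBounds.norm_sub_le (hB : BathBounds B b b' b'') {x x' y y' δ : ℝ}
    (hx : |x' - x| < |x|) (hy : |y' - y| < |y|) (hxδ : |x' - x| ≤ δ) (hyδ : |y' - y| ≤ δ) :
    ‖B x' y' - B x y‖ ≤ 2 * b' * δ := by
  have h0 := hB.nonneg'
  have hx0 : x ≠ 0 := ne_zero_of_mem_uIcc Set.left_mem_uIcc hx
  have hy0 : y' ≠ 0 := ne_zero_of_mem_uIcc Set.right_mem_uIcc hy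
  have h1 := hB.norm_sub_le₁ hx hy0
  have h2 := hB.norm_sub_le₂ hy hx0
  calc ‖B x' y' - B x y‖ = ‖(B x' y' - B x y') + (B x y' - B x y)‖ := by congr 1; abel
    _ ≤ b' * δ + b' * δ := norm_add_le_of_le (h1.trans (by gcongr)) (h2.trans (by gcongr))
    _ = _ := by ring

/-- Second partials are bounded but not assumed continuous, so the displacement is made one
coordinate at a time: Taylor in `x` at heights `y ± v`, transport of `∂₁B` to height `y` by the
mixed derivative, Taylor in `y`. The linear terms cancel and six remainders `b'' δ²` are left. -/
theorem BathBounds.norm_second_diff_le (hB : BathBounds B b b' b'') {x u y v δ : ℝ}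
    (hx : |u| < |x|) (hy : |v| < |y|) (hxδ : |u| ≤ δ) (hyδ : |v| ≤ δ) :
    ‖B (x + u) (y + v) + B (x - u) (y - v) - (B x y + B x y)‖ ≤ 6 * b'' * δ ^ 2 := by
  have h0 := hB.nonneg''
  have hδ : 0 ≤ δ := (abs_nonneg _).trans hxδ
  have hx0 : x ≠ 0 := ne_zero_of_mem_uIcc (y := x + u) Set.left_mem_uIcc (by simpa using hx)
  have hy0 : y ≠ 0 := ne_zero_of_mem_uIcc (y := y + v) Set.left_mem_uIcc (by simpa using hy)
  have hyp : y + v ≠ 0 := ne_zero_of_mem_uIcc (x := y) Set.right_mem_uIcc (by simpa using hy)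
  have hym : y - v ≠ 0 := ne_zero_of_mem_uIcc (x := y) Set.right_mem_uIcc (by simpa using hy)
  have e1 := hB.taylor₁ (x := x) (x' := x + u) (y := y + v) (by simpa using hx) hyp
  have e2 := hB.taylor₁ (x := x) (x' := x - u) (y := y - v) (by simpa using hx) hym
  have e3 := hB.norm_pderiv₁_sub_le₂ (x := x) (y := y) (y' := y + v) (by simpa using hy) hx0
  have e4 := hB.norm_pderiv₁_sub_le₂ (x := x) (y := y) (y' := y - v) (by simpa using hy) hx0
  have e5 := hB.taylor₂ (x := x) (y := y) (y' := y + v) (by simpa using hy) hx0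
  have e6 := hB.taylor₂ (x := x) (y := y) (y' := y - v) (by simpa using hy) hx0
  simp only [add_sub_cancel_left, sub_sub_cancel_left, abs_neg] at e1 e2 e3 e4 e5 e6
  have hu2 : b'' * |u| ^ 2 ≤ b'' * δ ^ 2 := by gcongr
  have hv2 : b'' * |v| ^ 2 ≤ b'' * δ ^ 2 := by gcongr
  have e34 : ‖u • (pderiv₁ B x (y + v) - pderiv₁ B x y) -
      u • (pderiv₁ B x (y - v) - pderiv₁ B x y)‖ ≤ b'' * δ ^ 2 + b'' * δ ^ 2 := by
    have huv : |u| * (b'' * |v|) ≤ b'' * δ ^ 2 := by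
      calc _ ≤ δ * (b'' * δ) := by gcongr
        _ = _ := by ring
    refine norm_sub_le_of_le ?_ ?_ <;> rw [norm_smul, Real.norm_eq_abs]
    · exact (mul_le_mul_of_nonneg_left e3 (abs_nonneg u)).trans huv
    · exact (mul_le_mul_of_nonneg_left e4 (abs_nonneg u)).trans huv
  have key : B (x + u) (y + v) + B (x - u) (y - v) - (B x y + B x y) =
      (B (x + u) (y + v) - B x (y + v) - u • pderiv₁ B x (y + v)) +
      (B (x - u) (y - v) - B x (y - v) - (-u) • pderiv₁ B x (y - v)) +
      (u • (pderiv₁ B x (y + v) - pderiv₁ B x y) - u • (pderiv₁ B x (y - v) - pderiv₁ B x y)) +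
      (B x (y + v) - B x y - v • pderiv₂ B x y) +
      (B x (y - v) - B x y - (-v) • pderiv₂ B x y) := by
    simp only [smul_sub, neg_smul]
    ring
  rw [key]
  refine (norm_add_le_of_le (norm_add_le_of_le (norm_add_le_of_le (norm_add_le_of_le
    (e1.trans hu2) (e2.trans hu2)) e34) (e5.trans hv2)) (e6.trans hv2)).trans (le_of_eq ?_)
  ring

/-- The summands `1` are for convenience: `1 + b ≥ 1` lets powers be raised later, and squaring `1 +
2 b' + 6 b''` dominates `6 b''`. -/
theorem BathBounds.secondDiffBound (hB : BathBounds B b b' b'') {ι : Type*} {δ : ℝ}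
    {x y z : ι → ℝ} (h : Reflects δ x y z) (i j : ι) :
    SecondDiffBound (B (x i) (x j)) (B (y i) (y j)) (B (z i) (z j)) (1 + b)
      ((1 + 2 * b' + 6 * b'') * δ) := by
  have h0 := hB.nonneg
  have h1 := hB.nonneg'
  have h2 := hB.nonneg''
  obtain ⟨hi1, hi2, hi3⟩ := h i
  obtain ⟨hj1, hj2, hj3⟩ := h j
  have hδ : 0 ≤ δ := (abs_nonneg _).trans hi1
  have hb : ∀ p q, ‖B p q‖ ≤ 1 + b := fun p q => (hB.bound p q).trans (by linarith)
  have hz : ∀ k, z k - x k = -(y k - x k) := fun k => by rw [(h k).2.2]; ring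
  have hd : 2 * b' * δ ≤ (1 + b) * ((1 + 2 * b' + 6 * b'') * δ) := by
    have : 2 * b' ≤ (1 + b) * (1 + 2 * b' + 6 * b'') := by
      nlinarith [mul_nonneg h0 h1, mul_nonneg h0 h2]
    calc _ ≤ ((1 + b) * (1 + 2 * b' + 6 * b'')) * δ := by gcongr
      _ = _ := by ring
  refine ⟨hb _ _, hb _ _, hb _ _, (hB.norm_sub_le hi2 hj2 hi1 hj1).trans hd,
    (hB.norm_sub_le ?_ ?_ ?_ ?_).trans hd, ?_⟩
  · rwa [hz, abs_neg]
  · rwa [hz, abs_neg]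
  · rwa [hz, abs_neg]
  · rwa [hz, abs_neg]
  · have := hB.norm_second_diff_le hi2 hj2 hi1 hj1
    rw [show x i + (y i - x i) = y i by ring, show x j + (y j - x j) = y j by ring,
      show x i - (y i - x i) = z i by rw [hi3]; ring,
      show x j - (y j - x j) = z j by rw [hj3]; ring] at this
    refine this.trans ?_
    have h3 : 6 * b'' ≤ (1 + b) * (1 + 2 * b' + 6 * b'') ^ 2 := by
      have : 6 * b'' ≤ (1 + 2 * b' + 6 * b'') ^ 2 := by nlinarith [mul_nonneg h1 h2]
      nlinarith [mul_nonneg h0 (sq_nonneg (1 + 2 * b' + 6 * b''))]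
    calc _ ≤ ((1 + b) * (1 + 2 * b' + 6 * b'') ^ 2) * δ ^ 2 := by gcongr
      _ = _ := by ring

/-- `B` is locally Lipschitz off the axes. This is the source of measurability of the Dyson
integrand, since `B` is not assumed measurable. -/
theorem BathBounds.continuousAt (hB : BathBounds B b b' b'') {x y : ℝ} (hx : x ≠ 0) (hy : y ≠ 0) :
    ContinuousAt (fun p : ℝ × ℝ => B p.1 p.2) (x, y) := by
  refine continuousAt_of_locally_lipschitz (r := min |x| |y|) (by positivity) (2 * b') ?_
  rintro ⟨x', y'⟩ h
  rw [Prod.dist_eq, max_lt_iff, lt_min_iff, lt_min_iff] at h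
  rw [dist_eq_norm]
  exact hB.norm_sub_le h.1.1 h.2.2 (le_max_left _ _) (le_max_right _ _)

theorem BathBounds.bathInfluence_secondDiffBound (hB : BathBounds B b b' b'') {N : ℕ} {δ : ℝ}
    {x y z : Fin N → ℝ} (hδ : 0 ≤ δ) (h : Reflects δ x y z) :
    SecondDiffBound (bathInfluence B x) (bathInfluence B y) (bathInfluence B z)
      ((pairings N).card * (1 + b) ^ N) (N * ((1 + 2 * b' + 6 * b'') * δ)) := by
  have h0 := hB.nonneg
  have h1 := hB.nonneg'
  have h2 := hB.nonneg''
  refine SecondDiffBound.sum _ fun σ _ => ?_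
  have hcard : (Finset.univ.filter fun i : Fin N => i < σ i).card ≤ N := by
    simpa using Finset.card_filter_le (Finset.univ : Finset (Fin N)) fun i => i < σ i
  refine (SecondDiffBound.prod _ fun i _ => hB.secondDiffBound h i (σ i)).mono (by positivity) ?_ ?_
  · exact pow_le_pow_right₀ (by linarith) hcard
  · gcongr

theorem BathBounds.norm_bathInfluence_le (hB : BathBounds B b b' b'') {N : ℕ} (x : Fin N → ℝ) :
    ‖bathInfluence B x‖ ≤ (pairings N).card * (1 + b) ^ N := by
  have h0 := hB.nonneg
  have key : ∀ σ ∈ pairings N,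
      ‖∏ i : Fin N with i < σ i, B (x i) (x (σ i))‖ ≤ (1 + b) ^ N := by
    intro σ _
    have hcard : (Finset.univ.filter fun i : Fin N => i < σ i).card ≤ N := by
      simpa using Finset.card_filter_le (Finset.univ : Finset (Fin N)) fun i => i < σ i
    rw [norm_prod]
    calc _ ≤ ∏ i : Fin N with i < σ i, (1 + b) :=
          Finset.prod_le_prod (fun _ _ => norm_nonneg _)
            fun i _ => (hB.bound _ _).trans (by linarith)
      _ = (1 + b) ^ (Finset.univ.filter fun i : Fin N => i < σ i).card := by simp
      _ ≤ _ := pow_le_pow_right₀ (by linarith) hcard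
  simpa [bathInfluence] using norm_sum_le_of_le _ key

theorem BathBounds.continuousAt_bathInfluence (hB : BathBounds B b b' b'') {N : ℕ} {x : Fin N → ℝ}
    (hx : ∀ i, x i ≠ 0) : ContinuousAt (fun x => bathInfluence B x) x := by
  unfold bathInfluence
  refine tendsto_finsetSum _ fun σ _ => tendsto_finsetProd _ fun i _ => ?_
  have h1 : ContinuousAt (fun x : Fin N → ℝ => (x i, x (σ i))) x := by fun_prop
  exact ContinuousAt.comp (f := fun x : Fin N → ℝ => (x i, x (σ i)))
    (g := fun p : ℝ × ℝ => B p.1 p.2) (hB.continuousAt (hx i) (hx (σ i))) h1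

end Bath

/-! ### The interaction picture -/

section System

variable {E : Type*} [NormedAddCommGroup E] [InnerProductSpace ℂ E] [CompleteSpace E]

theorem freeProp_eq (Hs : E →L[ℂ] E) (t : ℝ) :
    freeProp Hs t = NormedSpace.exp (t • ((-Complex.I) • Hs)) := by
  rw [freeProp, ← Complex.coe_smul, smul_smul, mul_comm]

@[simp] theorem freeProp_zero (Hs : E →L[ℂ] E) : freeProp Hs 0 = 1 := by
  simp [freeProp]

theorem freeProp_add (Hs : E →L[ℂ] E) (s t : ℝ) :
    freeProp Hs (s + t) = freeProp Hs s * freeProp Hs t := by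
  let +nondep : NormedAlgebra ℚ (E →L[ℂ] E) := .restrictScalars ℚ ℂ (E →L[ℂ] E)
  rw [freeProp_eq, freeProp_eq, freeProp_eq, add_smul]
  exact NormedSpace.exp_add_of_commute
    (((Commute.refl _).smul_left s).smul_right t)

theorem freeProp_mul_freeProp_neg (Hs : E →L[ℂ] E) (s : ℝ) :
    freeProp Hs s * freeProp Hs (-s) = 1 := by
  rw [← freeProp_add, add_neg_cancel, freeProp_zero]

theorem star_freeProp {Hs : E →L[ℂ] E} (h : IsSelfAdjoint Hs) (t : ℝ) :
    star (freeProp Hs t) = freeProp Hs (-t) := by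
  rw [freeProp, freeProp, NormedSpace.star_exp, star_smul, h.star_eq]
  simp

/-- The C⋆-identity for a unitary; only `‖1‖ ≤ 1` is used, so the zero space is covered. -/
theorem norm_freeProp_le {Hs : E →L[ℂ] E} (hH : IsSelfAdjoint Hs) (t : ℝ) :
    ‖freeProp Hs t‖ ≤ 1 := by
  have h := CStarRing.norm_star_mul_self (x := freeProp Hs t)
  rw [star_freeProp hH, ← freeProp_add, neg_add_cancel, freeProp_zero] at h
  have h1 : ‖freeProp Hs t‖ * ‖freeProp Hs t‖ ≤ 1 := h ▸ ContinuousLinearMap.norm_id_le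
  nlinarith [norm_nonneg (freeProp Hs t)]

theorem hasDerivAt_freeProp (Hs : E →L[ℂ] E) (t : ℝ) :
    HasDerivAt (freeProp Hs) (freeProp Hs t * ((-Complex.I) • Hs)) t := by
  have := hasDerivAt_exp_smul_const (𝕂 := ℝ) ((-Complex.I) • Hs) t
  rw [← freeProp_eq] at this
  exact this.congr_of_eventuallyEq (Filter.Eventually.of_forall fun s => freeProp_eq Hs s)

theorem commute_freeProp (Hs : E →L[ℂ] E) (t : ℝ) : Commute (freeProp Hs t) Hs := by
  exact ((Commute.refl Hs).smul_left _).exp_left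

/-- The operator `X` in the interaction picture at time `s`. -/
noncomputable def interaction (Hs X : E →L[ℂ] E) (s : ℝ) : E →L[ℂ] E :=
  freeProp Hs (-s) * X * freeProp Hs s

theorem norm_interaction_le {Hs : E →L[ℂ] E} (hH : IsSelfAdjoint Hs) (X : E →L[ℂ] E) (s : ℝ) :
    ‖interaction Hs X s‖ ≤ ‖X‖ := by
  calc _ ≤ ‖freeProp Hs (-s)‖ * ‖X‖ * ‖freeProp Hs s‖ := norm_mul₃_le
    _ ≤ 1 * ‖X‖ * 1 := by gcongr <;> exact norm_freeProp_le hH _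
    _ = _ := by ring

/-- The commutator with `i Hs`. -/
noncomputable def heisenberg (Hs X : E →L[ℂ] E) : E →L[ℂ] E :=
  Complex.I • (Hs * X - X * Hs)

theorem norm_heisenberg_le (Hs X : E →L[ℂ] E) : ‖heisenberg Hs X‖ ≤ 2 * ‖Hs‖ * ‖X‖ := by
  rw [heisenberg, norm_smul, Complex.norm_I, one_mul]
  refine (norm_sub_le_of_le (norm_mul_le _ _) (norm_mul_le _ _)).trans (le_of_eq ?_)
  ring

theorem hasDerivAt_interaction (Hs X : E →L[ℂ] E) (s : ℝ) :
    HasDerivAt (interaction Hs X) (interaction Hs (heisenberg Hs X) s) s := by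
  have h1 : HasDerivAt (fun s => freeProp Hs (-s)) (-(freeProp Hs (-s) * ((-Complex.I) • Hs))) s := by
    have h := (hasDerivAt_freeProp Hs (-s)).scomp s (hasDerivAt_neg s)
    rw [neg_one_smul] at h
    exact h
  have h2 := (h1.mul_const X).mul (hasDerivAt_freeProp Hs s)
  refine h2.congr_deriv ?_
  have hc := (commute_freeProp Hs s).eq
  simp only [interaction, heisenberg, mul_smul_comm, smul_mul_assoc, neg_smul, mul_neg, neg_neg, hc,
    mul_sub, sub_mul, smul_sub, mul_assoc]
  abel

theorem norm_interaction_sub_le {Hs : E →L[ℂ] E} (hH : IsSelfAdjoint Hs) (X : E →L[ℂ] E)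
    (s s' : ℝ) :
    ‖interaction Hs X s' - interaction Hs X s‖ ≤ 2 * ‖Hs‖ * ‖X‖ * |s' - s| :=
  norm_sub_le_of_hasDerivAt (fun z _ => hasDerivAt_interaction Hs X z) fun z _ =>
    (norm_interaction_le hH _ z).trans (norm_heisenberg_le Hs X)

theorem interaction_taylor {Hs : E →L[ℂ] E} (hH : IsSelfAdjoint Hs) (X : E →L[ℂ] E) (s s' : ℝ) :
    ‖interaction Hs X s' - interaction Hs X s - (s' - s) • interaction Hs (heisenberg Hs X) s‖ ≤
      4 * ‖Hs‖ ^ 2 * ‖X‖ * |s' - s| ^ 2 := by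
  refine norm_sub_sub_le_of_hasDerivAt (fun z _ => hasDerivAt_interaction Hs X z) (fun z _ => ?_)
    (by positivity)
  refine (norm_interaction_sub_le hH _ s z).trans ?_
  refine mul_le_mul_of_nonneg_right ?_ (abs_nonneg _)
  calc _ ≤ 2 * ‖Hs‖ * (2 * ‖Hs‖ * ‖X‖) :=
        mul_le_mul_of_nonneg_left (norm_heisenberg_le Hs X) (by positivity)
    _ = _ := by ring

/-- The linear Taylor terms at the two opposite displacements cancel. The remainders add up to `8
‖Hs‖² ‖X‖ δ²`, within the `16` given by the square of the rate. -/
theorem interaction_secondDiffBound {Hs : E →L[ℂ] E} (hH : IsSelfAdjoint Hs) (X : E →L[ℂ] E)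
    {x y z δ : ℝ} (hδ : |y - x| ≤ δ) (hxyz : z = 2 * x - y) :
    SecondDiffBound (interaction Hs X x) (interaction Hs X y) (interaction Hs X z)
      ‖X‖ (4 * ‖Hs‖ * δ) := by
  have hzx : z - x = -(y - x) := by rw [hxyz]; ring
  have hδ' : |z - x| ≤ δ := by rwa [hzx, abs_neg]
  have hδ0 := (abs_nonneg _).trans hδ
  have hd : 2 * ‖Hs‖ * ‖X‖ * δ ≤ ‖X‖ * (4 * ‖Hs‖ * δ) := by
    have : 0 ≤ ‖Hs‖ * ‖X‖ * δ := by positivity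
    linarith
  refine ⟨norm_interaction_le hH _ _, norm_interaction_le hH _ _, norm_interaction_le hH _ _,
    (norm_interaction_sub_le hH X _ _).trans (le_trans (by gcongr) hd),
    (norm_interaction_sub_le hH X _ _).trans (le_trans (by gcongr) hd), ?_⟩
  have h1 := interaction_taylor hH X x y
  have h2 := interaction_taylor hH X x z
  have key : interaction Hs X y + interaction Hs X z - (interaction Hs X x + interaction Hs X x) =
      (interaction Hs X y - interaction Hs X x - (y - x) • interaction Hs (heisenberg Hs X) x) +
      (interaction Hs X z - interaction Hs X x - (z - x) • interaction Hs (heisenberg Hs X) x) := by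
    rw [hzx, neg_smul]
    abel
  rw [key]
  refine (norm_add_le_of_le h1 h2).trans ?_
  calc _ ≤ 4 * ‖Hs‖ ^ 2 * ‖X‖ * δ ^ 2 + 4 * ‖Hs‖ ^ 2 * ‖X‖ * δ ^ 2 := by gcongr
    _ ≤ _ := by
      have : 0 ≤ ‖Hs‖ ^ 2 * ‖X‖ * δ ^ 2 := by positivity
      linarith

theorem continuous_interaction (Hs X : E →L[ℂ] E) : Continuous (interaction Hs X) :=
  continuous_iff_continuousAt.2 fun s => (hasDerivAt_interaction Hs X s).continuousAt

/-- `X(s_m) ⋯ X(s_1)` in the interaction picture. -/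
noncomputable def interactionProd (Hs X : E →L[ℂ] E) {m : ℕ} (s : Fin m → ℝ) : E →L[ℂ] E :=
  (List.ofFn fun i => interaction Hs X (s i)).reverse.prod

theorem interactionProd_succ (Hs X : E →L[ℂ] E) {m : ℕ} (s : Fin (m + 1) → ℝ) :
    interactionProd Hs X s =
      interaction Hs X (s (Fin.last m)) * interactionProd Hs X (Fin.init s) := by
  simp only [interactionProd, List.ofFn_succ', List.concat_eq_append, List.reverse_append,
    List.reverse_singleton, List.singleton_append, List.prod_cons]
  rfl

/-- The propagators between successive times split by the group law, so that `t` enters only through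
an outer factor. -/
theorem leftDyson_eq (Hs Ws : E →L[ℂ] E) {m : ℕ} (s : Fin m → ℝ) (t : ℝ) :
    leftDyson Hs Ws m s t = freeProp Hs t * interactionProd Hs Ws s := by
  induction m generalizing t with
  | zero => simp [leftDyson, interactionProd]
  | succ m ih =>
    rw [leftDyson, ih, interactionProd_succ, interaction, sub_eq_add_neg, freeProp_add]
    simp only [mul_assoc]

theorem rightDyson_eq {Hs Ws : E →L[ℂ] E} (hH : IsSelfAdjoint Hs) (hW : IsSelfAdjoint Ws) {m : ℕ}
    (s : Fin m → ℝ) (t : ℝ) : rightDyson Hs Ws m s t = star (leftDyson Hs Ws m s t) := by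
  induction m generalizing t with
  | zero => simp [rightDyson, leftDyson, star_freeProp hH]
  | succ m ih =>
    rw [rightDyson, leftDyson, ih]
    simp only [star_mul, star_freeProp hH, hW.star_eq, mul_assoc]

theorem interactionProd_secondDiffBound {Hs : E →L[ℂ] E} (hH : IsSelfAdjoint Hs) (X : E →L[ℂ] E)
    {m : ℕ} {x y z : Fin m → ℝ} {δ : ℝ} (h : Reflects δ x y z) :
    SecondDiffBound (interactionProd Hs X x) (interactionProd Hs X y) (interactionProd Hs X z)
      (‖X‖ ^ m) (m * (4 * ‖Hs‖ * δ)) :=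
  SecondDiffBound.list_prod_reverse ContinuousLinearMap.norm_id_le fun i =>
    interaction_secondDiffBound hH X (h i).1 (h i).2.2

theorem norm_interactionProd_le {Hs : E →L[ℂ] E} (hH : IsSelfAdjoint Hs) (X : E →L[ℂ] E)
    {m : ℕ} (s : Fin m → ℝ) : ‖interactionProd Hs X s‖ ≤ ‖X‖ ^ m :=
  (SecondDiffBound.list_prod_reverse (d := 0) ContinuousLinearMap.norm_id_le fun i =>
    SecondDiffBound.const (norm_interaction_le hH X (s i)) le_rfl).norm_mid

theorem continuous_interactionProd (Hs X : E →L[ℂ] E) {m : ℕ} :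
    Continuous fun s : Fin m → ℝ => interactionProd Hs X s := by
  induction m with
  | zero => simpa [interactionProd] using continuous_const
  | succ m ih =>
    simp only [interactionProd_succ]
    refine ((continuous_interaction Hs X).comp (continuous_apply _)).mul (ih.comp ?_)
    unfold Fin.init
    fun_prop

/-- The time points `-t_m, …, -t_1, t'_1, …, t'_{m'}`. -/
def signedTimes {m m' : ℕ} (s : Fin m → ℝ) (s' : Fin m' → ℝ) : Fin (m + m') → ℝ :=
  Fin.append (fun i => -s (Fin.rev i)) s'

theorem Reflects.signedTimes {m m' : ℕ} {δ : ℝ} {x y z : Fin m → ℝ} {x' y' z' : Fin m' → ℝ}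
    (h : Reflects δ x y z) (h' : Reflects δ x' y' z') :
    Reflects δ (signedTimes x x') (signedTimes y y') (signedTimes z z') := by
  intro i
  induction i using Fin.addCases with
  | left i =>
    obtain ⟨h1, h2, h3⟩ := h (Fin.rev i)
    have e : -y (Fin.rev i) - -x (Fin.rev i) = -(y (Fin.rev i) - x (Fin.rev i)) := by ring
    simp only [OpenSystem.signedTimes, Fin.append_left, e, abs_neg]
    exact ⟨h1, h2, by rw [h3]; ring⟩
  | right i => simpa only [OpenSystem.signedTimes, Fin.append_right] using h' i

/-- The integrand of the Dyson series in the interaction picture. -/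
noncomputable def kernel (Hs Ws ρ₀ : E →L[ℂ] E) (B : ℝ → ℝ → ℂ) {m m' : ℕ} (s : Fin m → ℝ)
    (s' : Fin m' → ℝ) : E →L[ℂ] E :=
  ((-Complex.I) ^ m * Complex.I ^ m' * bathInfluence B (signedTimes s s')) •
    (interactionProd Hs Ws s * ρ₀ * star (interactionProd Hs Ws s'))

theorem dysonIntegrand_eq {Hs Ws : E →L[ℂ] E} (hH : IsSelfAdjoint Hs) (hW : IsSelfAdjoint Ws)
    (ρ₀ : E →L[ℂ] E) (B : ℝ → ℝ → ℂ) (t : ℝ) (m m' : ℕ) (s : (Fin m → ℝ) × (Fin m' → ℝ)) :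
    dysonIntegrand Hs Ws ρ₀ B t m m' s =
      freeProp Hs t * kernel Hs Ws ρ₀ B s.1 s.2 * freeProp Hs (-t) := by
  rw [dysonIntegrand, kernel, rightDyson_eq hH hW, leftDyson_eq, leftDyson_eq, star_mul,
    star_freeProp hH, mul_smul_comm, smul_mul_assoc]
  simp only [mul_assoc, signedTimes]

variable {Hs Ws ρ₀ : E →L[ℂ] E} {B : ℝ → ℝ → ℂ} {b b' b'' : ℝ}

theorem norm_kernel_coeff (m m' : ℕ) : ‖(-Complex.I) ^ m * Complex.I ^ m'‖ = 1 := by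
  simp

theorem kernel_secondDiffBound (hH : IsSelfAdjoint Hs) (hB : BathBounds B b b' b'') {m m' : ℕ}
    {δ : ℝ} (hδ : 0 ≤ δ) {x y z : Fin m → ℝ} {x' y' z' : Fin m' → ℝ}
    (h : Reflects δ x y z) (h' : Reflects δ x' y' z') :
    SecondDiffBound (kernel Hs Ws ρ₀ B x x') (kernel Hs Ws ρ₀ B y y') (kernel Hs Ws ρ₀ B z z')
      ((pairings (m + m')).card * (‖ρ₀‖ * ((1 + b) * ‖Ws‖) ^ (m + m')))
      ((m + m' : ℕ) * ((1 + 2 * b' + 6 * b'' + 4 * ‖Hs‖) * δ)) := by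
  have h1 := hB.bathInfluence_secondDiffBound hδ (h.signedTimes h')
  have h0 := (SecondDiffBound.const (x := (-Complex.I) ^ m * Complex.I ^ m') (d := 0)
    (norm_kernel_coeff m m').le le_rfl).mul h1
  have h2 := interactionProd_secondDiffBound hH Ws h
  have h3 := (interactionProd_secondDiffBound hH Ws h').conj
  have h4 := h0.smul ((h2.mul (SecondDiffBound.const (x := ρ₀) (d := 0) le_rfl le_rfl)).mul h3)
  have ea : 1 * ((pairings (m + m')).card * (1 + b) ^ (m + m')) *
      (‖Ws‖ ^ m * ‖ρ₀‖ * ‖Ws‖ ^ m') =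
      (pairings (m + m')).card * (‖ρ₀‖ * ((1 + b) * ‖Ws‖) ^ (m + m')) := by
    rw [mul_pow]; ring
  have ed : 0 + (m + m' : ℕ) * ((1 + 2 * b' + 6 * b'') * δ) +
      (m * (4 * ‖Hs‖ * δ) + 0 + m' * (4 * ‖Hs‖ * δ)) =
      (m + m' : ℕ) * ((1 + 2 * b' + 6 * b'' + 4 * ‖Hs‖) * δ) := by
    push_cast; ring
  rw [ea, ed] at h4
  exact h4

theorem norm_kernel_le (hH : IsSelfAdjoint Hs) (hB : BathBounds B b b' b'') {m m' : ℕ}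
    (s : Fin m → ℝ) (s' : Fin m' → ℝ) :
    ‖kernel Hs Ws ρ₀ B s s'‖ ≤
      (pairings (m + m')).card * (‖ρ₀‖ * ((1 + b) * ‖Ws‖) ^ (m + m')) := by
  have h0 := hB.nonneg
  have h1 := hB.norm_bathInfluence_le (signedTimes s s')
  have h2 := norm_interactionProd_le hH Ws s
  have h3 := norm_interactionProd_le hH Ws s'
  rw [kernel, norm_smul, norm_mul, norm_kernel_coeff, one_mul]
  calc _ ≤ ‖bathInfluence B (signedTimes s s')‖ *
          (‖interactionProd Hs Ws s‖ * ‖ρ₀‖ * ‖star (interactionProd Hs Ws s')‖) := by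
        gcongr; exact norm_mul₃_le
    _ ≤ ((pairings (m + m')).card * (1 + b) ^ (m + m')) * (‖Ws‖ ^ m * ‖ρ₀‖ * ‖Ws‖ ^ m') := by
        rw [norm_star]; gcongr
    _ = _ := by rw [mul_pow]; ring

theorem continuousAt_kernel (hB : BathBounds B b b' b'') {m m' : ℕ}
    {s : (Fin m → ℝ) × (Fin m' → ℝ)} (hs : ∀ i, s.1 i ≠ 0) (hs' : ∀ i, s.2 i ≠ 0) :
    ContinuousAt (fun s : (Fin m → ℝ) × (Fin m' → ℝ) => kernel Hs Ws ρ₀ B s.1 s.2) s := by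
  have h0 : ∀ i, signedTimes s.1 s.2 i ≠ 0 := by
    intro i
    induction i using Fin.addCases with
    | left i => simpa [signedTimes] using hs (Fin.rev i)
    | right i => simpa [signedTimes] using hs' i
  have h1 : Continuous fun s : (Fin m → ℝ) × (Fin m' → ℝ) => signedTimes s.1 s.2 := by
    refine continuous_pi fun i => ?_
    induction i using Fin.addCases with
    | left i => simp only [signedTimes, Fin.append_left]; fun_prop
    | right i => simp only [signedTimes, Fin.append_right]; fun_prop
  have h2 : ContinuousAt
      (fun s : (Fin m → ℝ) × (Fin m' → ℝ) => bathInfluence B (signedTimes s.1 s.2)) s :=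
    ContinuousAt.comp (f := fun s : (Fin m → ℝ) × (Fin m' → ℝ) => signedTimes s.1 s.2)
      (g := fun x => bathInfluence B x) (hB.continuousAt_bathInfluence h0) h1.continuousAt
  have h3 : Continuous fun s : (Fin m → ℝ) × (Fin m' → ℝ) =>
      interactionProd Hs Ws s.1 * ρ₀ * star (interactionProd Hs Ws s.2) :=
    (((continuous_interactionProd Hs Ws).comp continuous_fst).mul continuous_const).mul
      ((continuous_interactionProd Hs Ws).comp continuous_snd).star
  exact (continuousAt_const.mul h2).smul h3.continuousAt

end System

/-! ### Counting cell assignments -/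

section Counting

variable {m n : ℕ}

/-- The number of points in each cell. -/
def occupation (c : Fin m → Fin n) (k : Fin n) : ℕ := (Finset.univ.filter fun i => c i = k).card

theorem sum_occupation (c : Fin m → Fin n) : ∑ k, occupation c k = m := by
  simpa [occupation] using (Finset.card_eq_sum_card_fiberwise (f := c)
    (s := (Finset.univ : Finset (Fin m))) (t := Finset.univ) (by simp)).symm

theorem prod_X_eq_monomial (c : Fin m → Fin n) :
    ∏ i, (MvPolynomial.X (c i) : MvPolynomial (Fin n) ℕ) =
      MvPolynomial.monomial (Finsupp.equivFunOnFinite.symm (occupation c)) 1 := by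
  rw [MvPolynomial.monomial_eq, Finsupp.prod_fintype _ _ (by simp)]
  simp only [map_one, one_mul, Finsupp.equivFunOnFinite_symm_apply_apply, occupation]
  rw [← Finset.prod_fiberwise' (Finset.univ) c fun k => (MvPolynomial.X k : MvPolynomial (Fin n) ℕ)]
  simp

/-- Compare coefficients in two expansions of `(∑ X_k) ^ m`: over all maps `c`, and by the
multinomial theorem. -/
theorem card_occupation_eq (j : Fin n → ℕ) (hj : ∑ k, j k = m) :
    (Finset.univ.filter fun c : Fin m → Fin n => occupation c = j).card =
      Nat.multinomial Finset.univ j := by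
  have h1 := Finset.sum_pow_eq_sum_piAntidiag Finset.univ
    (fun k : Fin n => (MvPolynomial.X k : MvPolynomial (Fin n) ℕ)) m
  rw [Fintype.sum_pow] at h1
  have h2 := congrArg (MvPolynomial.coeff (Finsupp.equivFunOnFinite.symm j)) h1
  have h3 : ∀ i : Fin n → ℕ, ∏ k, (MvPolynomial.X k : MvPolynomial (Fin n) ℕ) ^ i k =
      MvPolynomial.monomial (Finsupp.equivFunOnFinite.symm i) 1 := by
    intro i
    rw [MvPolynomial.monomial_eq, Finsupp.prod_fintype _ _ (by simp)]
    simp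
  simp only [prod_X_eq_monomial, h3, MvPolynomial.coeff_sum, MvPolynomial.coeff_monomial,
    ← nsmul_eq_mul, MvPolynomial.coeff_smul, EmbeddingLike.apply_eq_iff_eq] at h2
  simpa [Finset.sum_ite, hj] using h2

theorem sum_occupation_eq {X : Type*} [AddCommMonoid X] (φ : (Fin n → ℕ) → X) :
    ∑ c : Fin m → Fin n, φ (occupation c) =
      ∑ j ∈ Finset.piAntidiag Finset.univ m, Nat.multinomial Finset.univ j • φ j := by
  rw [← Finset.sum_fiberwise_of_maps_to (s := Finset.univ) (g := fun c : Fin m → Fin n => occupation c)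
    (t := Finset.piAntidiag Finset.univ m) (fun c _ => by simp [sum_occupation])]
  refine Finset.sum_congr rfl fun j hj => ?_
  rw [← card_occupation_eq j (by simpa using hj)]
  rw [Finset.sum_congr rfl (g := fun _ => φ j), Finset.sum_const]
  intro c hc
  rw [(Finset.mem_filter.1 hc).2]

/-- Overwriting the value at `j` by an arbitrary cell is injective, since the lost value `c j` is
still visible as `c i`. The version for triples overwrites two values. -/
theorem card_eq_mul_le {i j : Fin m} (hij : i ≠ j) :
    (Finset.univ.filter fun c : Fin m → Fin n => c i = c j).card * n ≤ n ^ m := by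
  have h := Finset.card_le_card_of_injOn
    (s := (Finset.univ.filter fun c : Fin m → Fin n => c i = c j) ×ˢ (Finset.univ : Finset (Fin n)))
    (t := (Finset.univ : Finset (Fin m → Fin n)))
    (fun p => Function.update p.1 j p.2) (by simp [Set.MapsTo]) ?_
  · simpa [Finset.card_product] using h
  · rintro ⟨c, k⟩ hc ⟨c', k'⟩ hc' h
    simp only [Finset.coe_product, Set.mem_prod, Finset.mem_coe, Finset.mem_filter,
      Finset.mem_univ, true_and, and_true] at hc hc' h
    have hk : ∀ l, Function.update c j k l = Function.update c' j k' l := fun l => by rw [h]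
    have h1 : k = k' := by simpa using hk j
    have h2 : ∀ l, l ≠ j → c l = c' l := fun l hl => by simpa [hl] using hk l
    have h3 : c = c' := by
      funext l
      by_cases hl : l = j
      · rw [hl, ← hc, ← hc', h2 i hij]
      · exact h2 l hl
    rw [h1, h3]

theorem card_eq_eq_mul_le {i j l : Fin m} (hij : i ≠ j) (hil : i ≠ l) (hjl : j ≠ l) :
    (Finset.univ.filter fun c : Fin m → Fin n => c i = c j ∧ c i = c l).card * n ^ 2 ≤ n ^ m := by
  have h := Finset.card_le_card_of_injOn
    (s := (Finset.univ.filter fun c : Fin m → Fin n => c i = c j ∧ c i = c l) ×ˢ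
      (Finset.univ : Finset (Fin n × Fin n)))
    (t := (Finset.univ : Finset (Fin m → Fin n)))
    (fun p => Function.update (Function.update p.1 j p.2.1) l p.2.2) (by simp [Set.MapsTo]) ?_
  · simpa [Finset.card_product, sq] using h
  · rintro ⟨c, k, p⟩ hc ⟨c', k', p'⟩ hc' h
    simp only [Finset.coe_product, Set.mem_prod, Finset.mem_coe, Finset.mem_filter,
      Finset.mem_univ, true_and, and_true] at hc hc' h
    have hk : ∀ q, Function.update (Function.update c j k) l p q =
      Function.update (Function.update c' j k') l p' q := fun q => by rw [h]
    have h0 : p = p' := by simpa using hk l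
    have h1 : k = k' := by simpa [hjl] using hk j
    have h2 : ∀ q, q ≠ j → q ≠ l → c q = c' q := fun q hq hq' => by simpa [hq, hq'] using hk q
    have h3 : c = c' := by
      funext q
      by_cases hq : q = j
      · rw [hq, ← hc.1, ← hc'.1, h2 i hij hil]
      · by_cases hq' : q = l
        · rw [hq', ← hc.2, ← hc'.2, h2 i hij hil]
        · exact h2 q hq hq'
    rw [h0, h1, h3]

theorem card_not_injective_mul_le :
    (Finset.univ.filter fun c : Fin m → Fin n => ¬ Function.Injective c).card * n ≤
      m ^ 2 * n ^ m := by
  classical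
  have hsub : (Finset.univ.filter fun c : Fin m → Fin n => ¬ Function.Injective c) ⊆
      (Finset.univ.filter fun p : Fin m × Fin m => p.1 ≠ p.2).biUnion
        fun p => Finset.univ.filter fun c : Fin m → Fin n => c p.1 = c p.2 := by
    intro c hc
    simp only [Finset.mem_filter, Finset.mem_univ, true_and, Function.Injective, not_forall] at hc
    obtain ⟨i, j, h, hij⟩ := hc
    simp only [Finset.mem_biUnion, Finset.mem_filter, Finset.mem_univ, true_and]
    exact ⟨(i, j), hij, h⟩
  have h1 := (Finset.card_le_card hsub).trans Finset.card_biUnion_le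
  calc _ ≤ (∑ p : Fin m × Fin m with p.1 ≠ p.2,
        (Finset.univ.filter fun c : Fin m → Fin n => c p.1 = c p.2).card) * n :=
        Nat.mul_le_mul_right _ h1
    _ = ∑ p : Fin m × Fin m with p.1 ≠ p.2,
        (Finset.univ.filter fun c : Fin m → Fin n => c p.1 = c p.2).card * n := Finset.sum_mul _ _ _
    _ ≤ ∑ p : Fin m × Fin m with p.1 ≠ p.2, n ^ m :=
        Finset.sum_le_sum fun p hp => card_eq_mul_le (Finset.mem_filter.1 hp).2
    _ ≤ ∑ p : Fin m × Fin m, n ^ m := Finset.sum_le_sum_of_subset (Finset.filter_subset _ _)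
    _ = _ := by simp [sq]

theorem card_two_lt_occupation_mul_le :
    (Finset.univ.filter fun c : Fin m → Fin n => ¬ ∀ k, occupation c k ≤ 2).card * n ^ 2 ≤
      m ^ 3 * n ^ m := by
  classical
  set P := Finset.univ.filter fun p : Fin m × Fin m × Fin m =>
    p.1 ≠ p.2.1 ∧ p.1 ≠ p.2.2 ∧ p.2.1 ≠ p.2.2
  have hsub : (Finset.univ.filter fun c : Fin m → Fin n => ¬ ∀ k, occupation c k ≤ 2) ⊆
      P.biUnion fun p => Finset.univ.filter fun c : Fin m → Fin n =>
        c p.1 = c p.2.1 ∧ c p.1 = c p.2.2 := by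
    intro c hc
    simp only [Finset.mem_filter, Finset.mem_univ, true_and, not_forall, not_le, occupation,
      Finset.two_lt_card] at hc
    obtain ⟨k, i, hi, j, hj, l, hl, hij, hil, hjl⟩ := hc
    simp only [Finset.mem_biUnion, Finset.mem_filter, Finset.mem_univ, true_and, P]
    exact ⟨(i, j, l), ⟨hij, hil, hjl⟩, hi.trans hj.symm, hi.trans hl.symm⟩
  have h1 := (Finset.card_le_card hsub).trans Finset.card_biUnion_le
  calc _ ≤ (∑ p ∈ P, (Finset.univ.filter fun c : Fin m → Fin n =>
        c p.1 = c p.2.1 ∧ c p.1 = c p.2.2).card) * n ^ 2 := Nat.mul_le_mul_right _ h1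
    _ = ∑ p ∈ P, (Finset.univ.filter fun c : Fin m → Fin n =>
        c p.1 = c p.2.1 ∧ c p.1 = c p.2.2).card * n ^ 2 := Finset.sum_mul _ _ _
    _ ≤ ∑ p ∈ P, n ^ m := Finset.sum_le_sum fun p hp => by
        obtain ⟨h1, h2, h3⟩ := (Finset.mem_filter.1 hp).2
        exact card_eq_eq_mul_le h1 h2 h3
    _ ≤ ∑ p : Fin m × Fin m × Fin m, n ^ m :=
        Finset.sum_le_sum_of_subset (Finset.filter_subset _ _)
    _ = _ := by simp [pow_succ, mul_assoc]

/-- The increasing list in which each `k` occurs `j k` times. -/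
def occupationList (j : Fin n → ℕ) : List (Fin n) :=
  (List.ofFn fun k => List.replicate (j k) k).flatten

theorem count_occupationList (j : Fin n → ℕ) (k : Fin n) : (occupationList j).count k = j k := by
  simp only [occupationList, List.count_flatten, List.map_ofFn, List.sum_ofFn, Function.comp_apply,
    List.count_replicate]
  simp

theorem sortedLE_occupationList (j : Fin n → ℕ) : (occupationList j).SortedLE := by
  rw [List.sortedLE_iff_pairwise, occupationList, List.pairwise_flatten, List.pairwise_ofFn]
  refine ⟨fun l hl => ?_, fun k k' hk x hx y hy => ?_⟩
  · obtain ⟨k, rfl⟩ := (List.mem_ofFn' _ _).1 hl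
    simp [List.pairwise_replicate]
  · rw [List.eq_of_mem_replicate hx, List.eq_of_mem_replicate hy]
    exact hk.le

theorem count_ofFn (c : Fin m → Fin n) (k : Fin n) : (List.ofFn c).count k = occupation c k := by
  rw [← Multiset.coe_count, ← Fin.univ_val_map, Multiset.count_map, occupation, Finset.card_def,
    Finset.filter_val]
  simp only [eq_comm]

/-- Two sorted lists with the same multiplicities coincide. -/
theorem occupationList_occupation (c : Fin m → Fin n) :
    occupationList (occupation c) = List.ofFn (c ∘ Tuple.sort c) := by
  refine List.Perm.eq_of_sortedLE (sortedLE_occupationList _)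
    (List.sortedLE_ofFn_iff.2 (Tuple.monotone_sort c)) ?_
  refine List.Perm.trans ?_ (Equiv.Perm.ofFn_comp_perm _ c).symm
  rw [List.perm_iff_count]
  intro k
  rw [count_occupationList, count_ofFn]

end Counting

/-! ### Symmetrization and decomposition into cells -/

section Partition

/-- Used for both decompositions of the cubes: into permuted simplices and into cells. -/
theorem integral_prod_partition {α β X ι κ : Type*} [MeasureSpace α] [MeasureSpace β]
    [SFinite (volume : Measure β)] [NormedAddCommGroup X] [NormedSpace ℝ X]
    [Fintype ι] [Fintype κ] {s : Set α} {t : Set β} {A : ι → Set α} {A' : κ → Set β}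
    (hA : ∀ i, MeasurableSet (A i)) (hA' : ∀ i, MeasurableSet (A' i))
    (hd : Pairwise (Function.onFun Disjoint A)) (hd' : Pairwise (Function.onFun Disjoint A'))
    (hs : (⋃ i, A i) =ᵐ[volume] s) (ht : (⋃ i, A' i) =ᵐ[volume] t) {F : α × β → X}
    (hF : ∀ i k, IntegrableOn F (A i ×ˢ A' k)) :
    IntegrableOn F (s ×ˢ t) ∧
      ∫ x in s ×ˢ t, F x = ∑ i, ∑ k, ∫ x in A i ×ˢ A' k, F x := by
  have hst : (⋃ p : ι × κ, A p.1 ×ˢ A' p.2) =ᵐ[volume] s ×ˢ t := by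
    rw [Set.iUnion_prod, Measure.volume_eq_prod]
    exact Measure.set_prod_ae_eq hs ht
  constructor
  · refine IntegrableOn.congr_set_ae ?_ hst.symm
    exact integrableOn_finite_iUnion.2 fun p => hF p.1 p.2
  · rw [← setIntegral_congr_set hst, integral_iUnion_fintype
      (s := fun p : ι × κ => A p.1 ×ˢ A' p.2) (fun p => (hA p.1).prod (hA' p.2)) _
      fun p => hF p.1 p.2, Fintype.sum_prod_type]
    rintro ⟨i, k⟩ ⟨i', k'⟩ hne
    rw [Function.onFun, Set.disjoint_prod]
    by_cases h : i = i'
    · right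
      exact hd' fun hk => hne (Prod.ext h hk)
    · left
      exact hd h

/-- The cube `(0, T)^m`. -/
def cube (m : ℕ) (T : ℝ) : Set (Fin m → ℝ) := Set.univ.pi fun _ => Set.Ioo 0 T

theorem ae_injective (m : ℕ) : ∀ᵐ τ : Fin m → ℝ, Function.Injective τ := by
  have h : ∀ i j : Fin m, i ≠ j → ∀ᵐ τ : Fin m → ℝ, τ i ≠ τ j := by
    intro i j hij
    have hne : LinearMap.ker ((LinearMap.proj i : (Fin m → ℝ) →ₗ[ℝ] ℝ) - LinearMap.proj j) ≠ ⊤ := by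
      rw [Ne, LinearMap.ker_eq_top]
      intro h
      have := LinearMap.congr_fun h (Pi.single i 1)
      simp [hij.symm] at this
    have := Measure.addHaar_submodule (volume : Measure (Fin m → ℝ)) _ hne
    rw [ae_iff]
    convert this using 2
    ext τ
    simp [sub_eq_zero]
  have h' : ∀ᵐ τ : Fin m → ℝ, ∀ i j : Fin m, i ≠ j → τ i ≠ τ j := by
    simpa only [ae_all_iff] using h
  filter_upwards [h'] with τ hτ i j
  exact not_imp_not.1 (hτ i j)

theorem measurableSet_simplex (m : ℕ) (T : ℝ) : MeasurableSet (simplex m T) := by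
  have : simplex m T = (⋂ i, ⋂ j, {s | i < j → s i < s j}) ∩ ⋂ i, {s | 0 < s i ∧ s i < T} := by
    ext s
    simp [simplex, StrictMono]
  rw [this]
  refine MeasurableSet.inter (MeasurableSet.iInter fun i => MeasurableSet.iInter fun j => ?_)
    (MeasurableSet.iInter fun i => ?_)
  · by_cases h : i < j
    · simpa [h] using measurableSet_lt (measurable_pi_apply i) (measurable_pi_apply j)
    · simp [h]
  · exact (measurableSet_lt measurable_const (measurable_pi_apply i)).inter
      (measurableSet_lt (measurable_pi_apply i) measurable_const)

/-- Permutation of the coordinates. -/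
def permEquiv {m : ℕ} (π : Equiv.Perm (Fin m)) : (Fin m → ℝ) ≃ᵐ (Fin m → ℝ) :=
  MeasurableEquiv.piCongrLeft (fun _ => ℝ) π.symm

theorem permEquiv_apply {m : ℕ} (π : Equiv.Perm (Fin m)) (τ : Fin m → ℝ) :
    permEquiv π τ = τ ∘ π := by
  funext i
  have := Equiv.piCongrLeft_apply_apply (fun _ => ℝ) π.symm τ (π i)
  simpa [permEquiv, MeasurableEquiv.coe_piCongrLeft] using this

theorem permEquiv_measurePreserving {m : ℕ} (π : Equiv.Perm (Fin m)) :
    MeasurePreserving (permEquiv π) :=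
  volume_measurePreserving_piCongrLeft (fun _ => ℝ) π.symm

theorem sort_eq_of_strictMono {m : ℕ} {τ : Fin m → ℝ} {π : Equiv.Perm (Fin m)}
    (h : StrictMono (τ ∘ π)) : Tuple.sort τ = π := by
  refine (Tuple.eq_sort_iff.2 ⟨h.monotone, fun i j hij he => ?_⟩).symm
  exact absurd he (h hij).ne

theorem iUnion_preimage_simplex_ae_eq (m : ℕ) (T : ℝ) :
    (⋃ π : Equiv.Perm (Fin m), permEquiv π ⁻¹' simplex m T) =ᵐ[volume] cube m T := by
  rw [Filter.eventuallyEq_set]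
  filter_upwards [ae_injective m] with τ hτ
  simp only [Set.mem_iUnion, Set.mem_preimage, permEquiv_apply, simplex, cube, Set.mem_ofPred_eq,
    Set.mem_pi, Set.mem_univ, true_imp_iff, Set.mem_Ioo]
  constructor
  · rintro ⟨π, -, h⟩ i
    simpa using h (π.symm i)
  · intro h
    exact ⟨Tuple.sort τ, (Tuple.monotone_sort τ).strictMono_of_injective
      (hτ.comp (Tuple.sort τ).injective), fun i => h _⟩

theorem pairwise_disjoint_preimage_simplex (m : ℕ) (T : ℝ) :
    Pairwise (Function.onFun Disjoint
      fun π : Equiv.Perm (Fin m) => permEquiv π ⁻¹' simplex m T) := by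
  intro π π' hne
  rw [Function.onFun, Set.disjoint_left]
  intro τ h h'
  simp only [Set.mem_preimage, permEquiv_apply, simplex, Set.mem_ofPred_eq] at h h'
  exact hne ((sort_eq_of_strictMono h.1).symm.trans (sort_eq_of_strictMono h'.1))

variable {X : Type*} [NormedAddCommGroup X] [NormedSpace ℝ X]

/-- The function on the cubes that agrees with `f` on increasing tuples and does not depend on the
order of the coordinates. -/
noncomputable def symmetrize {m m' : ℕ} (f : (Fin m → ℝ) × (Fin m' → ℝ) → X)
    (s : (Fin m → ℝ) × (Fin m' → ℝ)) : X :=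
  f (s.1 ∘ Tuple.sort s.1, s.2 ∘ Tuple.sort s.2)

/-- Up to a null set the cubes are the disjoint union of `m! m'!` permuted copies of the product of
simplices, and on each copy the symmetrized function is `f` after a measure-preserving map. The gain
is that all cells of the cubes have the same volume, including those that straddle the diagonals. -/
theorem integral_symmetrize {m m' : ℕ} {T : ℝ} {f : (Fin m → ℝ) × (Fin m' → ℝ) → X}
    (hf : IntegrableOn f (simplex m T ×ˢ simplex m' T)) :
    IntegrableOn (symmetrize f) (cube m T ×ˢ cube m' T) ∧
      ∫ s in cube m T ×ˢ cube m' T, symmetrize f s =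
        (m.factorial * m'.factorial : ℝ) • ∫ s in simplex m T ×ˢ simplex m' T, f s := by
  have hmp : ∀ (π : Equiv.Perm (Fin m)) (π' : Equiv.Perm (Fin m')),
      MeasurePreserving (MeasurableEquiv.prodCongr (permEquiv π) (permEquiv π')) := fun π π' =>
    (permEquiv_measurePreserving π).prod (permEquiv_measurePreserving π')
  have hpre : ∀ (π : Equiv.Perm (Fin m)) (π' : Equiv.Perm (Fin m')),
      (permEquiv π ⁻¹' simplex m T) ×ˢ (permEquiv π' ⁻¹' simplex m' T) =
        MeasurableEquiv.prodCongr (permEquiv π) (permEquiv π') ⁻¹'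
          (simplex m T ×ˢ simplex m' T) := fun π π' => rfl
  have hmeas : ∀ (k : ℕ) (π : Equiv.Perm (Fin k)),
      MeasurableSet (permEquiv π ⁻¹' simplex k T) := fun k π =>
    (permEquiv π).measurable (measurableSet_simplex k T)
  have heq : ∀ (π : Equiv.Perm (Fin m)) (π' : Equiv.Perm (Fin m')),
      Set.EqOn (f ∘ MeasurableEquiv.prodCongr (permEquiv π) (permEquiv π')) (symmetrize f)
        ((permEquiv π ⁻¹' simplex m T) ×ˢ (permEquiv π' ⁻¹' simplex m' T)) := by
    rintro π π' ⟨τ, τ'⟩ ⟨h, h'⟩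
    simp only [Set.mem_preimage, permEquiv_apply, simplex, Set.mem_ofPred_eq] at h h'
    have e1 : MeasurableEquiv.prodCongr (permEquiv π) (permEquiv π') (τ, τ') = (τ ∘ π, τ' ∘ π') := by
      rw [← permEquiv_apply, ← permEquiv_apply]; rfl
    simp only [symmetrize, sort_eq_of_strictMono h.1, sort_eq_of_strictMono h'.1,
      Function.comp_apply, e1]
  obtain ⟨h1, h2⟩ := integral_prod_partition (hmeas m) (hmeas m')
    (pairwise_disjoint_preimage_simplex m T) (pairwise_disjoint_preimage_simplex m' T)
    (iUnion_preimage_simplex_ae_eq m T) (iUnion_preimage_simplex_ae_eq m' T) (F := symmetrize f)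
    (fun π π' => by
      refine IntegrableOn.congr_fun ?_ (heq π π') ((hmeas m π).prod (hmeas m' π'))
      rw [hpre]
      exact ((hmp π π').integrableOn_comp_preimage (MeasurableEquiv.measurableEmbedding _)).2 hf)
  refine ⟨h1, h2.trans ?_⟩
  have h3 : ∀ (π : Equiv.Perm (Fin m)) (π' : Equiv.Perm (Fin m')),
      ∫ s in (permEquiv π ⁻¹' simplex m T) ×ˢ (permEquiv π' ⁻¹' simplex m' T), symmetrize f s =
        ∫ s in simplex m T ×ˢ simplex m' T, f s := by
    intro π π'
    rw [← setIntegral_congr_fun ((hmeas m π).prod (hmeas m' π')) (heq π π'), hpre]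
    exact (hmp π π').setIntegral_preimage_emb (MeasurableEquiv.measurableEmbedding _) f _
  simp only [h3, Finset.sum_const, Finset.card_univ, Fintype.card_perm, Fintype.card_fin,
    ← Nat.cast_smul_eq_nsmul ℝ, smul_smul]

/-- The product of the open cells `(c_i δ, (c_i + 1) δ)`. -/
def box {m n : ℕ} (δ : ℝ) (c : Fin m → Fin n) : Set (Fin m → ℝ) :=
  Set.univ.pi fun i => Set.Ioo ((c i : ℕ) * δ) (((c i : ℕ) + 1) * δ)

theorem mem_box {m n : ℕ} {δ : ℝ} {c : Fin m → Fin n} {τ : Fin m → ℝ} :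
    τ ∈ box δ c ↔ ∀ i, (c i : ℕ) * δ < τ i ∧ τ i < ((c i : ℕ) + 1) * δ := by
  simp [box, Set.mem_pi]

theorem measurableSet_box {m n : ℕ} (δ : ℝ) (c : Fin m → Fin n) : MeasurableSet (box δ c) :=
  MeasurableSet.univ_pi fun _ => measurableSet_Ioo

theorem box_lt_of_lt {m n : ℕ} {δ : ℝ} (hδ : 0 < δ) {c c' : Fin m → Fin n} {τ τ' : Fin m → ℝ}
    (h : τ ∈ box δ c) (h' : τ' ∈ box δ c') {i j : Fin m} (hij : c i < c' j) : τ i < τ' j := by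
  rw [mem_box] at h h'
  have h1 : ((c i : ℕ) : ℝ) + 1 ≤ ((c' j : ℕ) : ℝ) := by exact_mod_cast hij
  calc τ i < ((c i : ℕ) + 1) * δ := (h i).2
    _ ≤ (c' j : ℕ) * δ := by gcongr
    _ < τ' j := (h' j).1

theorem pairwise_disjoint_box {m n : ℕ} {δ : ℝ} (hδ : 0 < δ) :
    Pairwise (Function.onFun Disjoint fun c : Fin m → Fin n => box δ c) := by
  intro c c' hne
  rw [Function.onFun, Set.disjoint_left]
  intro τ h h'
  refine hne (funext fun i => ?_)
  rcases lt_trichotomy (c i) (c' i) with hlt | heq | hlt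
  · exact absurd (box_lt_of_lt hδ h h' hlt) (lt_irrefl _)
  · exact heq
  · exact absurd (box_lt_of_lt hδ h' h hlt) (lt_irrefl _)

theorem box_subset_cube {m n : ℕ} {δ : ℝ} (hδ : 0 < δ) (c : Fin m → Fin n) :
    box δ c ⊆ cube m (n * δ) := by
  intro τ h
  rw [mem_box] at h
  simp only [cube, Set.mem_pi, Set.mem_univ, true_imp_iff, Set.mem_Ioo]
  intro i
  have h1 : ((c i : ℕ) : ℝ) + 1 ≤ n := by exact_mod_cast (c i).2
  refine ⟨lt_of_le_of_lt (by positivity) (h i).1, (h i).2.trans_le ?_⟩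
  gcongr

theorem iUnion_box_ae_eq (m n : ℕ) {δ : ℝ} (hδ : 0 < δ) :
    (⋃ c : Fin m → Fin n, box δ c) =ᵐ[volume] cube m (n * δ) := by
  have h : ∀ᵐ τ : Fin m → ℝ, ∀ (i : Fin m) (k : ℕ), τ i ≠ k * δ := by
    simp only [ae_all_iff]
    exact fun i k => Measure.ae_eval_ne (fun _ : Fin m => (volume : Measure ℝ)) i _
  rw [Filter.eventuallyEq_set]
  filter_upwards [h] with τ hτ
  constructor
  · intro h
    obtain ⟨c, hc⟩ := Set.mem_iUnion.1 h
    exact box_subset_cube hδ c hc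
  · intro h
    simp only [cube, Set.mem_pi, Set.mem_univ, true_imp_iff, Set.mem_Ioo] at h
    have hfl : ∀ i, ⌊τ i / δ⌋₊ < n := fun i =>
      (Nat.floor_lt (div_nonneg (h i).1.le hδ.le)).2 ((div_lt_iff₀ hδ).2 (h i).2)
    refine Set.mem_iUnion.2 ⟨fun i => ⟨⌊τ i / δ⌋₊, hfl i⟩, mem_box.2 fun i => ⟨?_, ?_⟩⟩
    · refine lt_of_le_of_ne ?_ (hτ i _).symm
      exact (le_div_iff₀ hδ).1 (Nat.floor_le (div_nonneg (h i).1.le hδ.le))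
    · exact (div_lt_iff₀ hδ).1 (Nat.lt_floor_add_one _)

theorem volume_real_box {m n : ℕ} {δ : ℝ} (hδ : 0 ≤ δ) (c : Fin m → Fin n) :
    (volume (box δ c)).toReal = δ ^ m := by
  rw [box, Real.volume_pi_Ioo_toReal (fun i => by
    show ((c i : ℕ) : ℝ) * δ ≤ ((c i : ℕ) + 1) * δ
    linarith)]
  simp [add_mul]

theorem volume_real_box_prod {m m' n : ℕ} {δ : ℝ} (hδ : 0 ≤ δ) (c : Fin m → Fin n)
    (c' : Fin m' → Fin n) :
    (volume : Measure ((Fin m → ℝ) × (Fin m' → ℝ))).real (box δ c ×ˢ box δ c') = δ ^ (m + m') := by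
  rw [Measure.real, Measure.volume_eq_prod, Measure.prod_prod, ENNReal.toReal_mul,
    volume_real_box hδ, volume_real_box hδ, pow_add]

theorem volume_box_prod_lt_top {m m' n : ℕ} {δ : ℝ} (c : Fin m → Fin n) (c' : Fin m' → Fin n) :
    (volume : Measure ((Fin m → ℝ) × (Fin m' → ℝ))) (box δ c ×ˢ box δ c') < ⊤ := by
  rw [Measure.volume_eq_prod, Measure.prod_prod, box, box, Real.volume_pi_Ioo, Real.volume_pi_Ioo]
  exact ENNReal.mul_lt_top (ENNReal.prod_lt_top fun _ _ => ENNReal.ofReal_lt_top)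
    (ENNReal.prod_lt_top fun _ _ => ENNReal.ofReal_lt_top)

end Partition

/-! ### The error on a cell -/

section Cell

variable {X : Type*} [NormedAddCommGroup X] [NormedSpace ℝ X]

/-- The midpoints of the cells. -/
noncomputable def cellMid {m n : ℕ} (δ : ℝ) (c : Fin m → Fin n) (i : Fin m) : ℝ :=
  ((c i : ℕ) + 1 / 2) * δ

/-- Points of an open cell are less than `δ / 2` from its midpoint, which is at least `δ / 2` from
the origin; so no displacement reaches `0`. -/
theorem reflects_cellMid {m n : ℕ} {δ : ℝ} (hδ : 0 < δ) {c : Fin m → Fin n} {τ : Fin m → ℝ}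
    (h : τ ∈ box δ c) : Reflects δ (cellMid δ c) τ ((2 : ℝ) • cellMid δ c - τ) := by
  intro i
  obtain ⟨h1, h2⟩ := mem_box.1 h i
  have h0 : 0 ≤ ((c i : ℕ) : ℝ) * δ := by positivity
  have h3 : |τ i - cellMid δ c i| < δ / 2 := by
    rw [abs_lt, cellMid]
    constructor <;> linarith
  have h4 : δ / 2 ≤ |cellMid δ c i| := by
    rw [cellMid]
    exact le_trans (by linarith) (le_abs_self _)
  exact ⟨by linarith, by linarith, by simp⟩

theorem reflect_mem_box_iff {m n : ℕ} {δ : ℝ} {c : Fin m → Fin n} {τ : Fin m → ℝ} :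
    (2 : ℝ) • cellMid δ c - τ ∈ box δ c ↔ τ ∈ box δ c := by
  simp only [mem_box]
  refine forall_congr' fun i => ?_
  simp only [Pi.sub_apply, Pi.smul_apply, smul_eq_mul, cellMid]
  constructor <;> rintro ⟨h1, h2⟩ <;> constructor <;> linarith

theorem comp_sort_eq_of_mem_box {m n : ℕ} {δ : ℝ} (hδ : 0 < δ) {c : Fin m → Fin n} {τ : Fin m → ℝ}
    (h : τ ∈ box δ c) : c ∘ Tuple.sort τ = c ∘ Tuple.sort c := by
  refine Tuple.unique_monotone (fun i j hij => ?_) (Tuple.monotone_sort c)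
  by_contra hlt
  exact absurd (box_lt_of_lt hδ h h (not_le.1 hlt)) (not_lt.2 (Tuple.monotone_sort τ hij))

/-- Points in distinct cells are ordered as their cells. Hence the symmetrized function is `f` after
a fixed permutation on such a box, without creases. -/
theorem sort_eq_of_mem_box {m n : ℕ} {δ : ℝ} (hδ : 0 < δ) {c : Fin m → Fin n}
    (hc : Function.Injective c) {τ : Fin m → ℝ} (h : τ ∈ box δ c) :
    Tuple.sort τ = Tuple.sort c :=
  Equiv.ext fun i => hc (congrFun (comp_sort_eq_of_mem_box hδ h) i)

theorem cellMid_comp_sort {m n : ℕ} {δ : ℝ} (hδ : 0 < δ) {c : Fin m → Fin n} {τ : Fin m → ℝ}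
    (h : τ ∈ box δ c) : cellMid δ c ∘ Tuple.sort τ = cellMid δ (c ∘ Tuple.sort c) := by
  rw [← comp_sort_eq_of_mem_box hδ h]
  rfl

/-- The reflected point is permuted by the sorting of `τ`, not by its own, and need not be
increasing when points share a cell. -/
theorem reflects_comp_sort {m n : ℕ} {δ : ℝ} (hδ : 0 < δ) {c : Fin m → Fin n} {τ : Fin m → ℝ}
    (h : τ ∈ box δ c) : Reflects δ (cellMid δ (c ∘ Tuple.sort c)) (τ ∘ Tuple.sort τ)
      (((2 : ℝ) • cellMid δ c - τ) ∘ Tuple.sort τ) := by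
  rw [← cellMid_comp_sort hδ h]
  exact (reflects_cellMid hδ h).comp _

/-- The value of `f` at the increasing midpoints of the cells. -/
noncomputable def cellValue {m m' n : ℕ} (f : (Fin m → ℝ) × (Fin m' → ℝ) → X) (δ : ℝ)
    (c : Fin m → Fin n) (c' : Fin m' → Fin n) : X :=
  f (cellMid δ (c ∘ Tuple.sort c), cellMid δ (c' ∘ Tuple.sort c'))

variable {m m' n : ℕ} {δ M d : ℝ} {f : (Fin m → ℝ) × (Fin m' → ℝ) → X}

theorem norm_integral_box_le (hδ : 0 < δ)
    (hf : ∀ {x y z x' y' z'}, Reflects δ x y z → Reflects δ x' y' z' →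
      SecondDiffBound (f (x, x')) (f (y, y')) (f (z, z')) M d)
    (c : Fin m → Fin n) (c' : Fin m' → Fin n) :
    ‖∫ s in box δ c ×ˢ box δ c', symmetrize f s‖ ≤ δ ^ (m + m') * M := by
  refine (norm_setIntegral_le_of_norm_le_const (C := M) (volume_box_prod_lt_top c c')
    fun s hs => ?_).trans (le_of_eq ?_)
  · exact (hf (reflects_comp_sort hδ hs.1) (reflects_comp_sort hδ hs.2)).norm_fst
  · rw [volume_real_box_prod hδ.le, mul_comm]

variable [CompleteSpace X]

theorem setIntegral_box_const (hδ : 0 < δ) (c : Fin m → Fin n) (c' : Fin m' → Fin n) (x : X) :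
    ∫ _ in box δ c ×ˢ box δ c', x = δ ^ (m + m') • x := by
  rw [setIntegral_const, volume_real_box_prod hδ.le]

theorem norm_integral_box_sub_le (hδ : 0 < δ)
    (hf : ∀ {x y z x' y' z'}, Reflects δ x y z → Reflects δ x' y' z' →
      SecondDiffBound (f (x, x')) (f (y, y')) (f (z, z')) M d)
    (c : Fin m → Fin n) (c' : Fin m' → Fin n)
    (hint : IntegrableOn (symmetrize f) (box δ c ×ˢ box δ c')) :
    ‖(∫ s in box δ c ×ˢ box δ c', symmetrize f s) - δ ^ (m + m') • cellValue f δ c c'‖ ≤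
      δ ^ (m + m') * (M * d) := by
  rw [← setIntegral_box_const hδ c c', ← integral_sub hint
    (integrableOn_const (volume_box_prod_lt_top c c').ne)]
  refine (norm_setIntegral_le_of_norm_le_const (C := M * d) (volume_box_prod_lt_top c c')
    fun s hs => ?_).trans (le_of_eq ?_)
  · exact (hf (reflects_comp_sort hδ hs.1) (reflects_comp_sort hδ hs.2)).diff_fst
  · rw [volume_real_box_prod hδ.le, mul_comm]

/-- The reflection in the midpoint preserves the box and its volume, so twice the error is the
integral of a second difference. -/
theorem norm_integral_box_sub_le_of_injective (hδ : 0 < δ)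
    (hf : ∀ {x y z x' y' z'}, Reflects δ x y z → Reflects δ x' y' z' →
      SecondDiffBound (f (x, x')) (f (y, y')) (f (z, z')) M d)
    {c : Fin m → Fin n} {c' : Fin m' → Fin n} (hc : Function.Injective c)
    (hc' : Function.Injective c')
    (hint : IntegrableOn (symmetrize f) (box δ c ×ˢ box δ c')) :
    ‖(∫ s in box δ c ×ˢ box δ c', symmetrize f s) - δ ^ (m + m') • cellValue f δ c c'‖ ≤
      δ ^ (m + m') * (M * d ^ 2) := by
  set e := MeasurableEquiv.prodCongr (MeasurableEquiv.subLeft ((2 : ℝ) • cellMid δ c))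
    (MeasurableEquiv.subLeft ((2 : ℝ) • cellMid δ c')) with he
  have hmp : MeasurePreserving e :=
    (Measure.measurePreserving_sub_left volume ((2 : ℝ) • cellMid δ c)).prod
      (Measure.measurePreserving_sub_left volume ((2 : ℝ) • cellMid δ c'))
  have happ : ∀ s, e s = ((2 : ℝ) • cellMid δ c - s.1, (2 : ℝ) • cellMid δ c' - s.2) :=
    fun s => rfl
  have hpre : e ⁻¹' (box δ c ×ˢ box δ c') = box δ c ×ˢ box δ c' := by
    ext s
    simp only [Set.mem_preimage, happ, Set.mem_prod, reflect_mem_box_iff]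
  have hint' : IntegrableOn (symmetrize f ∘ e) (box δ c ×ˢ box δ c') := by
    have := (hmp.integrableOn_comp_preimage e.measurableEmbedding).2 hint
    rwa [hpre] at this
  have heq : ∫ s in box δ c ×ˢ box δ c', (symmetrize f ∘ e) s =
      ∫ s in box δ c ×ˢ box δ c', symmetrize f s := by
    have := hmp.setIntegral_preimage_emb e.measurableEmbedding (symmetrize f)
      (box δ c ×ˢ box δ c')
    rwa [hpre] at this
  set v := cellValue f δ c c' with hv
  have hsum : ∫ s in box δ c ×ˢ box δ c', (symmetrize f s + (symmetrize f ∘ e) s - (v + v)) =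
      (2 : ℝ) • ((∫ s in box δ c ×ˢ box δ c', symmetrize f s) - δ ^ (m + m') • v) := by
    have hadd : IntegrableOn (fun s => symmetrize f s + (symmetrize f ∘ e) s)
        (box δ c ×ˢ box δ c') := hint.add hint'
    rw [integral_sub hadd (integrableOn_const (volume_box_prod_lt_top c c').ne),
      integral_add hint hint', heq, setIntegral_box_const hδ]
    module
  have hbound : ‖∫ s in box δ c ×ˢ box δ c',
      (symmetrize f s + (symmetrize f ∘ e) s - (v + v))‖ ≤ M * d ^ 2 * δ ^ (m + m') := by
    rw [← volume_real_box_prod hδ.le c c']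
    refine norm_setIntegral_le_of_norm_le_const (volume_box_prod_lt_top c c') fun s hs => ?_
    have h1 := reflects_comp_sort hδ hs.1
    have h2 := reflects_comp_sort hδ hs.2
    -- Injectivity enters here: `s` and its reflection are sorted by the same permutation, that of
    -- the cells.
    rw [sort_eq_of_mem_box hδ hc hs.1] at h1
    rw [sort_eq_of_mem_box hδ hc' hs.2] at h2
    have h3 := (hf h1 h2).second_diff
    simpa only [hv, cellValue, symmetrize, Function.comp_apply, happ, sort_eq_of_mem_box hδ hc hs.1,
      sort_eq_of_mem_box hδ hc' hs.2, sort_eq_of_mem_box hδ hc (reflect_mem_box_iff.2 hs.1),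
      sort_eq_of_mem_box hδ hc' (reflect_mem_box_iff.2 hs.2)] using h3
  rw [hsum, norm_smul, Real.norm_ofNat] at hbound
  have h0 := norm_nonneg ((∫ s in box δ c ×ˢ box δ c', symmetrize f s) - δ ^ (m + m') • v)
  linarith

/-- At most two points in each cell. -/
def AtMostTwo (c : Fin m → Fin n) : Prop := ∀ k, occupation c k ≤ 2

instance (c : Fin m → Fin n) : Decidable (AtMostTwo c) := by
  unfold AtMostTwo; infer_instance

/-- The indicators put all cells under one formula that can be summed: `d ^ 2` everywhere, an extra
`d` for a shared cell, and an extra `1` for an overfull cell, which the scheme omits. -/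
theorem norm_integral_box_sub_ite_le (hδ : 0 < δ) (hd : 0 ≤ d) (hM : 0 ≤ M)
    (hf : ∀ {x y z x' y' z'}, Reflects δ x y z → Reflects δ x' y' z' →
      SecondDiffBound (f (x, x')) (f (y, y')) (f (z, z')) M d)
    (c : Fin m → Fin n) (c' : Fin m' → Fin n)
    (hint : IntegrableOn (symmetrize f) (box δ c ×ˢ box δ c')) :
    ‖(∫ s in box δ c ×ˢ box δ c', symmetrize f s) -
        (if AtMostTwo c ∧ AtMostTwo c' then δ ^ (m + m') • cellValue f δ c c' else 0)‖ ≤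
      δ ^ (m + m') * M * (d ^ 2 +
        d * ((if ¬ Function.Injective c then 1 else 0) +
          (if ¬ Function.Injective c' then 1 else 0)) +
        ((if ¬ AtMostTwo c then 1 else 0) + (if ¬ AtMostTwo c' then 1 else 0))) := by
  have hq : 0 ≤ δ ^ (m + m') * M := by positivity
  have hite : ∀ (p : Prop) [Decidable p], (0 : ℝ) ≤ if p then 1 else 0 := by
    intro p _; split_ifs <;> norm_num
  have g1 := hite (¬ Function.Injective c)
  have g2 := hite (¬ Function.Injective c')
  have g3 := hite (¬ AtMostTwo c)
  have g4 := hite (¬ AtMostTwo c')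
  by_cases h2 : AtMostTwo c ∧ AtMostTwo c'
  · rw [if_pos h2]
    by_cases h1 : Function.Injective c ∧ Function.Injective c'
    · refine (norm_integral_box_sub_le_of_injective hδ hf h1.1 h1.2 hint).trans ?_
      rw [← mul_assoc]
      refine mul_le_mul_of_nonneg_left ?_ hq
      nlinarith [mul_nonneg hd (add_nonneg g1 g2)]
    · refine (norm_integral_box_sub_le hδ hf c c' hint).trans ?_
      rw [← mul_assoc]
      refine mul_le_mul_of_nonneg_left ?_ hq
      have : (1 : ℝ) ≤ (if ¬ Function.Injective c then 1 else 0) +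
          (if ¬ Function.Injective c' then 1 else 0) := by
        rcases not_and_or.1 h1 with h | h
        · rw [if_pos h]; linarith
        · rw [if_pos h]; linarith
      nlinarith [mul_le_mul_of_nonneg_left this hd, sq_nonneg d]
  · rw [if_neg h2, sub_zero]
    refine (norm_integral_box_le hδ hf c c').trans ?_
    have : (1 : ℝ) ≤ (if ¬ AtMostTwo c then 1 else 0) + (if ¬ AtMostTwo c' then 1 else 0) := by
      rcases not_and_or.1 h2 with h | h
      · rw [if_pos h]; linarith
      · rw [if_pos h]; linarith
    refine le_mul_of_one_le_right hq ?_
    nlinarith [mul_nonneg hd (add_nonneg g1 g2), sq_nonneg d]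

theorem sum_sum_add {α β : Type*} [Fintype α] [Fintype β] (u : α → ℝ) (v : β → ℝ) :
    ∑ a, ∑ b, (u a + v b) = Fintype.card β * ∑ a, u a + Fintype.card α * ∑ b, v b := by
  simp [Finset.sum_add_distrib, Finset.mul_sum]

theorem norm_integral_simplex_sub_le (hδ : 0 < δ) (hd : 0 ≤ d) (hM : 0 ≤ M)
    (hf : ∀ {x y z x' y' z'}, Reflects δ x y z → Reflects δ x' y' z' →
      SecondDiffBound (f (x, x')) (f (y, y')) (f (z, z')) M d)
    (hint : IntegrableOn f (simplex m (n * δ) ×ˢ simplex m' (n * δ))) :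
    ‖(∑ c : Fin m → Fin n, ∑ c' : Fin m' → Fin n,
        if AtMostTwo c ∧ AtMostTwo c' then
          (δ ^ (m + m') / (m.factorial * m'.factorial)) • cellValue f δ c c' else 0) -
      ∫ s in simplex m (n * δ) ×ˢ simplex m' (n * δ), f s‖ ≤
      (n * δ) ^ (m + m') / (m.factorial * m'.factorial) * M *
        (d ^ 2 + d * (m ^ 2 + m' ^ 2) / n + (m ^ 3 + m' ^ 3) / n ^ 2) := by
  obtain ⟨h1, h2⟩ := integral_symmetrize hint
  have hbox : ∀ (c : Fin m → Fin n) (c' : Fin m' → Fin n),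
      IntegrableOn (symmetrize f) (box δ c ×ˢ box δ c') := fun c c' =>
    h1.mono_set (Set.prod_mono (box_subset_cube hδ c) (box_subset_cube hδ c'))
  have h3 := (integral_prod_partition (measurableSet_box δ) (measurableSet_box δ)
    (pairwise_disjoint_box hδ) (pairwise_disjoint_box hδ) (iUnion_box_ae_eq m n hδ)
    (iUnion_box_ae_eq m' n hδ) hbox).2
  rw [h2] at h3
  set q : ℝ := m.factorial * m'.factorial with hq
  have hq0 : 0 < q := by positivity
  set I := ∫ s in simplex m (n * δ) ×ˢ simplex m' (n * δ), f s with hI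
  have key : (∑ c : Fin m → Fin n, ∑ c' : Fin m' → Fin n,
        if AtMostTwo c ∧ AtMostTwo c' then (δ ^ (m + m') / q) • cellValue f δ c c' else 0) - I =
      -(q⁻¹ • ∑ c : Fin m → Fin n, ∑ c' : Fin m' → Fin n,
        ((∫ s in box δ c ×ˢ box δ c', symmetrize f s) -
        (if AtMostTwo c ∧ AtMostTwo c' then δ ^ (m + m') • cellValue f δ c c' else 0))) := by
    simp only [Finset.sum_sub_distrib]
    rw [← h3, smul_sub, smul_smul, inv_mul_cancel₀ hq0.ne', one_smul, neg_sub, Finset.smul_sum]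
    congr 1
    refine Finset.sum_congr rfl fun c _ => ?_
    rw [Finset.smul_sum]
    refine Finset.sum_congr rfl fun c' _ => ?_
    rw [smul_ite, smul_zero, smul_smul, div_eq_inv_mul]
  rw [key, norm_neg, norm_smul, Real.norm_eq_abs, abs_of_pos (inv_pos.2 hq0)]
  have h4 : ‖∑ c : Fin m → Fin n, ∑ c' : Fin m' → Fin n,
        ((∫ s in box δ c ×ˢ box δ c', symmetrize f s) -
        (if AtMostTwo c ∧ AtMostTwo c' then δ ^ (m + m') • cellValue f δ c c' else 0))‖ ≤
      ∑ c : Fin m → Fin n, ∑ c' : Fin m' → Fin n, δ ^ (m + m') * M * (d ^ 2 +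
        d * ((if ¬ Function.Injective c then 1 else 0) +
          (if ¬ Function.Injective c' then 1 else 0)) +
        ((if ¬ AtMostTwo c then 1 else 0) + (if ¬ AtMostTwo c' then 1 else 0))) :=
    norm_sum_le_of_le _ fun c _ => norm_sum_le_of_le _ fun c' _ =>
      norm_integral_box_sub_ite_le hδ hd hM hf c c' (hbox c c')
  have hni : ∀ k : ℕ, (∑ c : Fin k → Fin n, if ¬ Function.Injective c then (1 : ℝ) else 0) ≤
      k ^ 2 * n ^ k / n := by
    intro k
    -- For `n = 0` the right side is `0` by the convention for division. So is the left side: there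
    -- is no map if `k > 0`, and the only map is injective if `k = 0`.
    rcases Nat.eq_zero_or_pos n with rfl | hn
    · rcases k with _ | k <;> simp [Function.injective_of_subsingleton]
    rw [Finset.sum_boole, le_div_iff₀ (by exact_mod_cast hn)]
    exact_mod_cast card_not_injective_mul_le
  have htr : ∀ k : ℕ, (∑ c : Fin k → Fin n, if ¬ AtMostTwo c then (1 : ℝ) else 0) ≤
      k ^ 3 * n ^ k / n ^ 2 := by
    intro k
    rcases Nat.eq_zero_or_pos n with rfl | hn
    · rcases k with _ | k <;> simp [AtMostTwo]
    rw [Finset.sum_boole, le_div_iff₀ (by positivity)]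
    exact_mod_cast card_two_lt_occupation_mul_le
  have h5 : ∑ c : Fin m → Fin n, ∑ c' : Fin m' → Fin n, δ ^ (m + m') * M * (d ^ 2 +
        d * ((if ¬ Function.Injective c then 1 else 0) +
          (if ¬ Function.Injective c' then 1 else 0)) +
        ((if ¬ AtMostTwo c then 1 else 0) + (if ¬ AtMostTwo c' then 1 else 0))) ≤
      δ ^ (m + m') * M * (n ^ m * n ^ m' * d ^ 2 +
        d * (n ^ m' * (m ^ 2 * n ^ m / n) + n ^ m * (m' ^ 2 * n ^ m' / n)) +
        (n ^ m' * (m ^ 3 * n ^ m / n ^ 2) + n ^ m * (m' ^ 3 * n ^ m' / n ^ 2))) := by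
    simp only [← Finset.mul_sum]
    refine mul_le_mul_of_nonneg_left ?_ (by positivity)
    rw [Finset.sum_congr rfl fun c _ => Finset.sum_add_distrib, Finset.sum_add_distrib,
      Finset.sum_congr rfl fun c _ => Finset.sum_add_distrib, Finset.sum_add_distrib]
    simp only [← Finset.mul_sum, sum_sum_add]
    simp only [Finset.sum_const, Finset.card_univ, Fintype.card_fun, Fintype.card_fin,
      nsmul_eq_mul, Nat.cast_pow]
    have a1 := hni m
    have a2 := hni m'
    have a3 := htr m
    have a4 := htr m'
    rw [mul_assoc]
    gcongr
  calc _ ≤ q⁻¹ * (δ ^ (m + m') * M * (n ^ m * n ^ m' * d ^ 2 +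
        d * (n ^ m' * (m ^ 2 * n ^ m / n) + n ^ m * (m' ^ 2 * n ^ m' / n)) +
        (n ^ m' * (m ^ 3 * n ^ m / n ^ 2) + n ^ m * (m' ^ 3 * n ^ m' / n ^ 2)))) :=
        mul_le_mul_of_nonneg_left (h4.trans h5) (inv_pos.2 hq0).le
    _ = _ := by
        rw [mul_pow, pow_add (n : ℝ)]
        ring

end Cell

/-! ### The terms of the Dyson series -/

section Dyson

theorem volume_cube (m : ℕ) (T : ℝ) : volume (cube m T) = ENNReal.ofReal T ^ m := by
  simp [cube, Real.volume_pi_Ioo]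

theorem simplex_subset_cube (m : ℕ) (T : ℝ) : simplex m T ⊆ cube m T := fun _ hs _ _ => hs.2 _

theorem volume_cube_prod_lt_top (m m' : ℕ) (T : ℝ) :
    volume (cube m T ×ˢ cube m' T) < ⊤ := by
  rw [Measure.volume_eq_prod, Measure.prod_prod, volume_cube, volume_cube]
  exact ENNReal.mul_lt_top (ENNReal.pow_lt_top ENNReal.ofReal_lt_top)
    (ENNReal.pow_lt_top ENNReal.ofReal_lt_top)

theorem volume_real_cube_prod (m m' : ℕ) {T : ℝ} (hT : 0 ≤ T) :
    volume.real (cube m T ×ˢ cube m' T) = T ^ (m + m') := by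
  rw [Measure.real, Measure.volume_eq_prod, Measure.prod_prod, volume_cube, volume_cube,
    ENNReal.toReal_mul, ENNReal.toReal_pow, ENNReal.toReal_pow, ENNReal.toReal_ofReal hT, pow_add]

theorem norm_integral_simplex_le {X : Type*} [NormedAddCommGroup X] [NormedSpace ℝ X] {m m' : ℕ}
    {T M : ℝ} (hT : 0 ≤ T) {f : (Fin m → ℝ) × (Fin m' → ℝ) → X}
    (hint : IntegrableOn f (simplex m T ×ˢ simplex m' T)) (hf : ∀ s, ‖f s‖ ≤ M) :
    ‖∫ s in simplex m T ×ˢ simplex m' T, f s‖ ≤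
      T ^ (m + m') / (m.factorial * m'.factorial) * M := by
  have h1 := norm_setIntegral_le_of_norm_le_const (f := symmetrize f)
    (volume_cube_prod_lt_top m m' T) fun s _ => hf _
  rw [(integral_symmetrize hint).2, norm_smul, volume_real_cube_prod m m' hT,
    Real.norm_of_nonneg (by positivity)] at h1
  rw [div_mul_eq_mul_div, le_div_iff₀ (by positivity)]
  linarith

variable {E : Type*} [NormedAddCommGroup E] [InnerProductSpace ℂ E] [CompleteSpace E]
  {Hs Ws ρ₀ : E →L[ℂ] E} {B : ℝ → ℝ → ℂ} {b b' b'' : ℝ}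

/-- The simplices are open and avoid the axes, so the kernel is continuous there, as well as
bounded. -/
theorem integrableOn_kernel (hH : IsSelfAdjoint Hs) (hB : BathBounds B b b' b'') (m m' : ℕ)
    (T : ℝ) :
    IntegrableOn (fun s : (Fin m → ℝ) × (Fin m' → ℝ) => kernel Hs Ws ρ₀ B s.1 s.2)
      (simplex m T ×ˢ simplex m' T) := by
  have hms : MeasurableSet (simplex m T ×ˢ simplex m' T) :=
    (measurableSet_simplex m T).prod (measurableSet_simplex m' T)
  refine IntegrableOn.of_bound ((measure_mono (Set.prod_mono (simplex_subset_cube m T)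
    (simplex_subset_cube m' T))).trans_lt (volume_cube_prod_lt_top m m' T)) ?_ _
    (Filter.Eventually.of_forall fun s => norm_kernel_le hH hB s.1 s.2)
  refine ContinuousOn.aestronglyMeasurable (fun s hs => ContinuousAt.continuousWithinAt ?_) hms
  exact continuousAt_kernel hB (fun i => (hs.1.2 i).1.ne') fun i => (hs.2.2 i).1.ne'

theorem dysonIntegrand_eq_comp (hH : IsSelfAdjoint Hs) (hW : IsSelfAdjoint Ws) (t : ℝ) (m m' : ℕ) :
    dysonIntegrand Hs Ws ρ₀ B t m m' = fun s => ContinuousLinearMap.mulLeftRight ℝ (E →L[ℂ] E)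
      (freeProp Hs t) (freeProp Hs (-t)) (kernel Hs Ws ρ₀ B s.1 s.2) := by
  funext s
  rw [dysonIntegrand_eq hH hW, ContinuousLinearMap.mulLeftRight_apply]

theorem integrableOn_dysonIntegrand (hH : IsSelfAdjoint Hs) (hW : IsSelfAdjoint Ws)
    (hB : BathBounds B b b' b'') (m m' : ℕ) (t : ℝ) :
    IntegrableOn (dysonIntegrand Hs Ws ρ₀ B t m m') (simplex m t ×ˢ simplex m' t) := by
  rw [dysonIntegrand_eq_comp hH hW]
  exact ContinuousLinearMap.integrable_comp _ (integrableOn_kernel hH hB m m' t)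

theorem dysonTerm_eq (hH : IsSelfAdjoint Hs) (hW : IsSelfAdjoint Ws)
    (hB : BathBounds B b b' b'') (t : ℝ) (p : ℕ × ℕ) :
    dysonTerm Hs Ws ρ₀ B t p = freeProp Hs t *
      (∫ s in simplex p.1 t ×ˢ simplex p.2 t, kernel Hs Ws ρ₀ B s.1 s.2) * freeProp Hs (-t) := by
  rw [dysonTerm, dysonIntegrand_eq_comp hH hW,
    ContinuousLinearMap.integral_comp_comm _ (integrableOn_kernel hH hB p.1 p.2 t),
    ContinuousLinearMap.mulLeftRight_apply]

theorem norm_conj_freeProp_le (hH : IsSelfAdjoint Hs) (t : ℝ) (A : E →L[ℂ] E) :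
    ‖freeProp Hs t * A * freeProp Hs (-t)‖ ≤ ‖A‖ := by
  calc _ ≤ ‖freeProp Hs t‖ * ‖A‖ * ‖freeProp Hs (-t)‖ := norm_mul₃_le
    _ ≤ 1 * ‖A‖ * 1 := by gcongr <;> exact norm_freeProp_le hH _
    _ = _ := by ring

end Dyson

/-! ### The scheme in the interaction picture -/

section Lists

theorem bathInfluence_cast (B : ℝ → ℝ → ℂ) {N N' : ℕ} (h : N = N') (x : Fin N' → ℝ) :
    bathInfluence B (fun i => x (Fin.cast h i)) = bathInfluence B x := by
  subst h; rfl

theorem bathInfluence_get_ofFn (B : ℝ → ℝ → ℂ) {N : ℕ} (x : Fin N → ℝ) :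
    bathInfluence B (List.ofFn x).get = bathInfluence B x := by
  rw [← bathInfluence_cast B (List.length_ofFn (f := x)) x]
  congr 1
  funext i
  simp only [List.get_ofFn]

theorem ofFn_signedTimes {m m' : ℕ} (s : Fin m → ℝ) (s' : Fin m' → ℝ) :
    List.ofFn (signedTimes s s') =
      (List.ofFn s).reverse.map (fun x => -x) ++ List.ofFn s' := by
  rw [signedTimes, List.ofFn_fin_append]
  congr 1
  refine List.ext_getElem (by simp) fun k h1 h2 => ?_
  simp only [List.getElem_ofFn, List.getElem_map, List.getElem_reverse, List.length_ofFn, neg_inj]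
  congr 1
  ext
  simp only [List.length_ofFn] at h1
  simp only [Fin.val_rev]
  omega

/-- The increasing list in which the midpoint of the `k`-th cell occurs `j k` times. -/
noncomputable def midList (δ : ℝ) {n : ℕ} (j : Fin n → ℕ) : List ℝ :=
  (List.ofFn fun k : Fin n => List.replicate (j k) ((((k : ℕ) : ℝ) + 1 / 2) * δ)).flatten

theorem midList_succ (δ : ℝ) {n : ℕ} (j : Fin (n + 1) → ℕ) :
    midList δ j = midList δ (fun k => j k.castSucc) ++
      List.replicate (j (Fin.last n)) (((n : ℝ) + 1 / 2) * δ) := by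
  simp only [midList, List.ofFn_succ', List.concat_eq_append, List.flatten_append,
    List.flatten_singleton, Fin.val_castSucc, Fin.val_last]

theorem length_midList (δ : ℝ) {n : ℕ} (j : Fin n → ℕ) : (midList δ j).length = ∑ k, j k := by
  simp [midList, List.length_flatten, List.map_ofFn, List.sum_ofFn, Function.comp_def]

theorem midList_occupation (δ : ℝ) {m n : ℕ} (c : Fin m → Fin n) :
    midList δ (occupation c) = List.ofFn (cellMid δ (c ∘ Tuple.sort c)) := by
  have h : midList δ (occupation c) =
      (occupationList (occupation c)).map fun k : Fin n => (((k : ℕ) : ℝ) + 1 / 2) * δ := by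
    simp [midList, occupationList, List.map_flatten, List.map_ofFn, Function.comp_def]
  rw [h, occupationList_occupation, List.map_ofFn]
  rfl

theorem midpoints_eq (δ : ℝ) {n : ℕ} (jm jp : Fin n → Fin 3) :
    midpoints δ jm jp = (midList δ fun k => (jm k : ℕ)).reverse.map (fun x => -x) ++
      midList δ fun k => (jp k : ℕ) := by
  simp only [midpoints, midList, neg_mul, List.reverse_flatten, List.map_flatten, List.map_ofFn,
    List.map_reverse, Function.comp_def, List.reverse_replicate, List.map_replicate]

end Lists

/-! ### Telescoping of the one-step operators -/

section Scheme

variable {E : Type*} [NormedAddCommGroup E] [InnerProductSpace ℂ E] [CompleteSpace E]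

/-- The integrand of the Dyson series in the interaction picture, for lists of time points. -/
noncomputable def listKernel (Hs Ws ρ₀ : E →L[ℂ] E) (B : ℝ → ℝ → ℂ) (l l' : List ℝ) : E →L[ℂ] E :=
  ((-Complex.I) ^ l.length * Complex.I ^ l'.length *
      bathInfluence B (l.reverse.map (fun x => -x) ++ l').get) •
    ((l.map (interaction Hs Ws)).reverse.prod * ρ₀ *
      star (l'.map (interaction Hs Ws)).reverse.prod)

theorem listKernel_ofFn (Hs Ws ρ₀ : E →L[ℂ] E) (B : ℝ → ℝ → ℂ) {m m' : ℕ} (s : Fin m → ℝ)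
    (s' : Fin m' → ℝ) :
    listKernel Hs Ws ρ₀ B (List.ofFn s) (List.ofFn s') = kernel Hs Ws ρ₀ B s s' := by
  rw [listKernel, ← ofFn_signedTimes, bathInfluence_get_ofFn, kernel]
  simp only [List.length_ofFn, List.map_ofFn, interactionProd]
  rfl

/-- With `a = k - 1` the outer propagators run from time `(k - 1) δ` and to time `k δ`, so they
cancel between consecutive steps. In all three cases the scalar is `(-i δ) ^ j / j!`, the
coefficient of an exponential series. -/
theorem stepOp_eq (Hs Ws : E →L[ℂ] E) (δ a : ℝ) (j : Fin 3) :
    stepOp Hs Ws δ j = ((-Complex.I) ^ (j : ℕ) * ((δ ^ (j : ℕ) / (j : ℕ).factorial : ℝ) : ℂ)) •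
      (freeProp Hs ((a + 1) * δ) * interaction Hs Ws ((a + 1 / 2) * δ) ^ (j : ℕ) *
        freeProp Hs (-(a * δ))) := by
  set μ := (a + 1 / 2) * δ with hμ
  have e1 : freeProp Hs ((a + 1) * δ) * freeProp Hs (-μ) = freeProp Hs (δ / 2) := by
    rw [← freeProp_add, hμ]; congr 1; ring
  have e2 : freeProp Hs μ * freeProp Hs (-(a * δ)) = freeProp Hs (δ / 2) := by
    rw [← freeProp_add, hμ]; congr 1; ring
  have e3 : freeProp Hs ((a + 1) * δ) * freeProp Hs (-(a * δ)) = freeProp Hs δ := by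
    rw [← freeProp_add]; congr 1; ring
  have e4 := freeProp_mul_freeProp_neg Hs μ
  clear_value μ
  fin_cases j
  · simp [stepOp, e3]
  · have : freeProp Hs ((a + 1) * δ) * interaction Hs Ws μ * freeProp Hs (-(a * δ)) =
        (freeProp Hs ((a + 1) * δ) * freeProp Hs (-μ)) * Ws *
          (freeProp Hs μ * freeProp Hs (-(a * δ))) := by
      simp only [interaction, mul_assoc]
    simp [stepOp, this, e1, e2]
  · have : freeProp Hs ((a + 1) * δ) * (interaction Hs Ws μ * interaction Hs Ws μ) *
        freeProp Hs (-(a * δ)) = (freeProp Hs ((a + 1) * δ) * freeProp Hs (-μ)) *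
          (Ws * (freeProp Hs μ * freeProp Hs (-μ)) * Ws) *
          (freeProp Hs μ * freeProp Hs (-(a * δ))) := by
      simp only [interaction, mul_assoc]
    simp [stepOp, this, e1, e2, e4, pow_two]

theorem prod_map_star {A : Type*} [Monoid A] [StarMul A] (l : List A) :
    (l.map star).prod = star l.reverse.prod := by
  induction l with
  | nil => simp
  | cons a l ih => simp [ih]

/-- The weight `∏ δ ^ j_k / j_k!`. -/
noncomputable def weight (δ : ℝ) {n : ℕ} (j : Fin n → ℕ) : ℝ := ∏ k, δ ^ j k / (j k).factorial

theorem stepOp_prod_eq (Hs Ws : E →L[ℂ] E) (δ : ℝ) {n : ℕ} (j : Fin n → Fin 3) :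
    (List.ofFn fun k => stepOp Hs Ws δ (j k)).reverse.prod =
      ((-Complex.I) ^ (∑ k, (j k : ℕ)) * ((weight δ fun k => (j k : ℕ) : ℝ) : ℂ)) •
        (freeProp Hs (n * δ) *
          ((midList δ fun k => (j k : ℕ)).map (interaction Hs Ws)).reverse.prod) := by
  induction n with
  | zero => simp [weight, midList]
  | succ n ih =>
    simp only [List.ofFn_succ', List.concat_eq_append, List.reverse_append, List.reverse_singleton,
      List.singleton_append, List.prod_cons]
    rw [ih, stepOp_eq Hs Ws δ n, midList_succ, weight, weight, Fin.sum_univ_castSucc,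
      Fin.prod_univ_castSucc, List.map_append, List.reverse_append, List.prod_append,
      List.map_replicate, List.reverse_replicate, List.prod_replicate, smul_mul_smul_comm]
    congr 1
    · push_cast
      ring
    · have := freeProp_mul_freeProp_neg Hs (-(n * δ))
      rw [neg_neg] at this
      push_cast
      rw [mul_assoc _ (freeProp Hs (-(n * δ))), ← mul_assoc (freeProp Hs (-(n * δ))), this, one_mul,
        mul_assoc]

theorem secondOrderScheme_eq {Hs Ws : E →L[ℂ] E} (hH : IsSelfAdjoint Hs) (ρ₀ : E →L[ℂ] E)
    (B : ℝ → ℝ → ℂ) (δ : ℝ) (n : ℕ) :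
    secondOrderScheme Hs Ws ρ₀ B δ n = freeProp Hs (n * δ) *
      (∑ jm : Fin n → Fin 3, ∑ jp : Fin n → Fin 3,
        weight δ (fun k => (jm k : ℕ)) • weight δ (fun k => (jp k : ℕ)) •
          listKernel Hs Ws ρ₀ B (midList δ fun k => (jm k : ℕ)) (midList δ fun k => (jp k : ℕ))) *
      freeProp Hs (-(n * δ)) := by
  simp only [secondOrderScheme, Finset.mul_sum, Finset.sum_mul]
  refine Finset.sum_congr rfl fun jm _ => Finset.sum_congr rfl fun jp _ => ?_
  have hstar : (List.ofFn fun k => star (stepOp Hs Ws δ (jp k))).prod =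
      star (List.ofFn fun k => stepOp Hs Ws δ (jp k)).reverse.prod := by
    rw [← prod_map_star, List.map_ofFn]
    rfl
  have hconj : ∀ (k : ℕ) (r : ℝ), star ((-Complex.I) ^ k * (r : ℂ)) = Complex.I ^ k * r := by
    intro k r
    simp
  rw [hstar, stepOp_prod_eq, stepOp_prod_eq, listKernel, midpoints_eq, length_midList,
    length_midList, star_smul, hconj, star_mul, star_freeProp hH]
  simp only [← Complex.coe_smul, smul_mul_assoc, mul_smul_comm, smul_smul, mul_assoc]
  congr 1
  ring

end Scheme

/-! ### The scheme as a sum over cell assignments -/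

section Regroup

variable {X : Type*} [AddCommGroup X] [Module ℝ X] {n : ℕ}

theorem le_of_atMostTwo {m : ℕ} {c : Fin m → Fin n} (h : AtMostTwo c) : m ≤ 2 * n := by
  rw [← sum_occupation c]
  calc ∑ k, occupation c k ≤ ∑ _k : Fin n, 2 := Finset.sum_le_sum fun k _ => h k
    _ = 2 * n := by simp [mul_comm]

/-- The identity that makes the scheme a quadrature rule: the multinomial coefficient is the number
of cell assignments with occupation `j`, each weighted by `δ ^ m / m!`. -/
theorem weight_eq (δ : ℝ) {m : ℕ} {j : Fin n → ℕ} (hj : ∑ k, j k = m) :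
    weight δ j = Nat.multinomial Finset.univ j * (δ ^ m / m.factorial) := by
  have h := Nat.multinomial_spec Finset.univ j
  rw [hj] at h
  rw [weight, Finset.prod_div_distrib, Finset.prod_pow_eq_pow_sum, hj, ← h]
  push_cast
  have h1 : (∏ k, ((j k).factorial : ℝ)) ≠ 0 :=
    Finset.prod_ne_zero_iff.2 fun k _ => by positivity
  have h2 : (Nat.multinomial Finset.univ j : ℝ) ≠ 0 := by
    exact_mod_cast (Nat.multinomial_pos Finset.univ j).ne'
  field_simp

theorem sum_fin_three_eq {Y : Type*} [AddCommMonoid Y] (g : (Fin n → ℕ) → Y) (m : ℕ) :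
    ∑ j : Fin n → Fin 3 with ∑ k, (j k : ℕ) = m, g (fun k => (j k : ℕ)) =
      ∑ j ∈ Finset.piAntidiag Finset.univ m, if ∀ k, j k ≤ 2 then g j else 0 := by
  rw [← Finset.sum_filter]
  refine Finset.sum_bij (fun j _ k => (j k : ℕ)) ?_ ?_ ?_ ?_
  · intro j hj
    simp only [Finset.mem_filter, Finset.mem_univ, true_and] at hj
    simp only [Finset.mem_filter, Finset.mem_piAntidiag, Finset.mem_univ, implies_true, and_true]
    exact ⟨hj, fun k => by omega⟩
  · intro j _ j' _ h
    funext k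
    exact Fin.ext (congrFun h k)
  · intro j hj
    simp only [Finset.mem_filter, Finset.mem_piAntidiag, Finset.mem_univ, implies_true,
      and_true] at hj
    exact ⟨fun k => ⟨j k, by have := hj.2 k; omega⟩, by simpa using hj.1, rfl⟩
  · intro j _
    rfl

/-- Each `j` of total `m` is spread over the cell assignments with occupation `j`. Totals stop at `2
n` because each of the `n` cells holds at most two points. -/
theorem sum_weight_eq (δ : ℝ) (φ : (Fin n → ℕ) → X) :
    ∑ j : Fin n → Fin 3, weight δ (fun k => (j k : ℕ)) • φ (fun k => (j k : ℕ)) =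
      ∑ m ∈ Finset.range (2 * n + 1), ∑ c : Fin m → Fin n,
        if AtMostTwo c then (δ ^ m / m.factorial) • φ (occupation c) else 0 := by
  rw [← Finset.sum_fiberwise_of_maps_to (g := fun j : Fin n → Fin 3 => ∑ k, (j k : ℕ))
    (t := Finset.range (2 * n + 1))]
  · refine Finset.sum_congr rfl fun m _ => ?_
    rw [sum_fin_three_eq (fun j => weight δ j • φ j) m]
    have h := sum_occupation_eq (m := m)
      fun j : Fin n → ℕ => if ∀ k, j k ≤ 2 then (δ ^ m / m.factorial) • φ j else 0
    simp only [AtMostTwo]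
    rw [h]
    refine Finset.sum_congr rfl fun j hj => ?_
    rw [smul_ite, smul_zero, ← Nat.cast_smul_eq_nsmul ℝ, smul_smul,
      weight_eq δ (by simpa using hj)]
  · intro j _
    rw [Finset.mem_range, Nat.lt_succ_iff]
    calc ∑ k, (j k : ℕ) ≤ ∑ _k : Fin n, 2 := Finset.sum_le_sum fun k _ => by omega
      _ = 2 * n := by simp [mul_comm]

end Regroup

/-! ### Summation of the errors over all orders of the Dyson series -/

section Final

variable {E : Type*} [NormedAddCommGroup E] [InnerProductSpace ℂ E] [CompleteSpace E]

/-- The terms of the scheme with `m` points on the left branch and `m'` on the right branch. -/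
noncomputable def schemeTerm (Hs Ws ρ₀ : E →L[ℂ] E) (B : ℝ → ℝ → ℂ) (δ : ℝ) (n : ℕ) (p : ℕ × ℕ) :
    E →L[ℂ] E :=
  ∑ c : Fin p.1 → Fin n, ∑ c' : Fin p.2 → Fin n,
    if AtMostTwo c ∧ AtMostTwo c' then
      (δ ^ (p.1 + p.2) / (p.1.factorial * p.2.factorial)) •
        cellValue (fun s => kernel Hs Ws ρ₀ B s.1 s.2) δ c c' else 0

theorem schemeTerm_eq_zero (Hs Ws ρ₀ : E →L[ℂ] E) (B : ℝ → ℝ → ℂ) (δ : ℝ) (n : ℕ) {p : ℕ × ℕ}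
    (hp : p ∉ Finset.range (2 * n + 1) ×ˢ Finset.range (2 * n + 1)) :
    schemeTerm Hs Ws ρ₀ B δ n p = 0 := by
  refine Finset.sum_eq_zero fun c _ => Finset.sum_eq_zero fun c' _ => if_neg fun h => hp ?_
  simp only [Finset.mem_product, Finset.mem_range, Nat.lt_succ_iff]
  exact ⟨le_of_atMostTwo h.1, le_of_atMostTwo h.2⟩

theorem secondOrderScheme_eq_sum {Hs Ws : E →L[ℂ] E} (hH : IsSelfAdjoint Hs) (ρ₀ : E →L[ℂ] E)
    (B : ℝ → ℝ → ℂ) (δ : ℝ) (n : ℕ) :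
    secondOrderScheme Hs Ws ρ₀ B δ n = freeProp Hs (n * δ) *
      (∑ p ∈ Finset.range (2 * n + 1) ×ˢ Finset.range (2 * n + 1),
        schemeTerm Hs Ws ρ₀ B δ n p) * freeProp Hs (-(n * δ)) := by
  rw [secondOrderScheme_eq hH]
  congr 2
  simp only [← Finset.smul_sum]
  rw [sum_weight_eq δ fun j => ∑ jp : Fin n → Fin 3, weight δ (fun k => (jp k : ℕ)) •
    listKernel Hs Ws ρ₀ B (midList δ j) (midList δ fun k => (jp k : ℕ)), Finset.sum_product]
  refine Finset.sum_congr rfl fun m _ => ?_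
  simp only [schemeTerm]
  refine Eq.trans (Finset.sum_congr rfl fun c _ => ?_) Finset.sum_comm
  rw [sum_weight_eq δ fun j => listKernel Hs Ws ρ₀ B (midList δ (occupation c)) (midList δ j)]
  split_ifs with h
  · rw [Finset.smul_sum]
    refine Finset.sum_congr rfl fun m' _ => ?_
    rw [Finset.smul_sum]
    refine Finset.sum_congr rfl fun c' _ => ?_
    by_cases h' : AtMostTwo c'
    · rw [if_pos h', if_pos ⟨h, h'⟩, smul_smul, midList_occupation, midList_occupation,
        listKernel_ofFn, cellValue]
      congr 1
      rw [pow_add, mul_div_mul_comm]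
    · rw [if_neg h', if_neg fun hh => h' hh.2, smul_zero]
  · simp [h]

/-- The summable majorant of the Dyson series. -/
noncomputable def majorant (x : ℝ) (p : ℕ × ℕ) : ℝ :=
  (pairings (p.1 + p.2)).card * x ^ (p.1 + p.2) / (p.1.factorial * p.2.factorial)

/-- With `u` the general term, `2 u ≤ 2 ^ m u² + 2 ^ (-m)`, where `2 ^ m u²` is a term of the
exponential series of `2 x²`. -/
theorem summable_pow_div_sqrt_factorial (x : ℝ) (hx : 0 ≤ x) :
    Summable fun m : ℕ => x ^ m / √(m.factorial : ℝ) := by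
  have h1 : Summable fun m : ℕ => (2 * x ^ 2) ^ m / (m.factorial : ℝ) + (1 / 2 : ℝ) ^ m :=
    (Real.summable_pow_div_factorial _).add summable_geometric_two
  refine h1.of_nonneg_of_le (fun m => by positivity) fun m => ?_
  have hs : 0 < √(m.factorial : ℝ) := Real.sqrt_pos.2 (by positivity)
  have hss : √(m.factorial : ℝ) ^ 2 = m.factorial := Real.sq_sqrt (by positivity)
  set u := x ^ m / √(m.factorial : ℝ) with hu
  have hu2 : u ^ 2 = (x ^ 2) ^ m / m.factorial := by
    rw [hu, div_pow, hss, ← pow_mul, ← pow_mul, mul_comm m 2]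
  have hu0 : 0 ≤ u := by positivity
  clear_value u
  rw [mul_pow, mul_div_assoc, ← hu2, div_pow, one_pow]
  have hp : (0 : ℝ) < 2 ^ m := by positivity
  have : 2 * u ≤ 2 ^ m * u ^ 2 + 1 / 2 ^ m := by
    rw [← sub_nonneg]
    have e : 2 ^ m * u ^ 2 + 1 / 2 ^ m - 2 * u = 2 ^ m * (u - 1 / 2 ^ m) ^ 2 := by
      field_simp
      ring
    rw [e]
    positivity
  linarith

theorem majorant_nonneg {x : ℝ} (hx : 0 ≤ x) (p : ℕ × ℕ) : 0 ≤ majorant x p := by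
  unfold majorant; positivity

/-- Since `(m + m')! ≤ 2 ^ (m + m') m! m'!`, the square-root bound on the number of pairings splits,
and the majorant lies below a product of two convergent single series at `√2 x`. -/
theorem summable_majorant {x : ℝ} (hx : 0 ≤ x) : Summable (majorant x) := by
  have h := summable_pow_div_sqrt_factorial (√2 * x) (by positivity)
  refine (h.mul_of_nonneg h (fun m => by positivity) fun m => by positivity).of_nonneg_of_le
    (majorant_nonneg hx) ?_
  rintro ⟨m, m'⟩
  have hs : 0 < √(m.factorial : ℝ) := Real.sqrt_pos.2 (by positivity)
  have hs' : 0 < √(m'.factorial : ℝ) := Real.sqrt_pos.2 (by positivity)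
  have hss : √(m.factorial : ℝ) * √(m.factorial : ℝ) = m.factorial :=
    Real.mul_self_sqrt (by positivity)
  have hss' : √(m'.factorial : ℝ) * √(m'.factorial : ℝ) = m'.factorial :=
    Real.mul_self_sqrt (by positivity)
  have hc : ((pairings (m + m')).card : ℝ) ≤
      √2 ^ (m + m') * (√(m.factorial : ℝ) * √(m'.factorial : ℝ)) := by
    refine le_of_sq_le_sq ?_ (by positivity)
    rw [mul_pow, mul_pow, ← pow_mul, mul_comm _ 2, pow_mul, Real.sq_sqrt (by norm_num), sq √_,
      sq √_, hss, hss']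
    refine (pairings_card_sq_le (m + m')).trans ?_
    rw [← Nat.add_choose_mul_factorial_mul_factorial, mul_assoc]
    push_cast
    gcongr
    exact_mod_cast Nat.choose_le_two_pow _ _
  simp only [majorant]
  calc _ ≤ √2 ^ (m + m') * (√(m.factorial : ℝ) * √(m'.factorial : ℝ)) * x ^ (m + m') /
        (m.factorial * m'.factorial) := by gcongr
    _ = _ := by
      generalize √(m.factorial : ℝ) = u at *
      generalize √(m'.factorial : ℝ) = v at *
      rw [← hss, ← hss']
      field_simp
      ring

theorem pow_le_eight_pow (N : ℕ) : (N : ℝ) ^ 2 ≤ 8 ^ N ∧ (N : ℝ) ^ 3 ≤ 8 ^ N := by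
  have h : (N : ℝ) ≤ 2 ^ N := by exact_mod_cast Nat.lt_two_pow_self.le
  have h1 : (1 : ℝ) ≤ 2 ^ N := one_le_pow₀ (by norm_num)
  have h3 : (8 : ℝ) ^ N = (2 ^ N) ^ 3 := by rw [← pow_mul, mul_comm, pow_mul]; norm_num
  rw [h3]
  constructor
  · calc (N : ℝ) ^ 2 ≤ (2 ^ N) ^ 2 := by gcongr
      _ ≤ (2 ^ N) ^ 3 := pow_le_pow_right₀ h1 (by norm_num)
  · gcongr

/-- Here `y` stands for `1 / T`, so that `δ * y` is `1 / n`; each of the three sources of error then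
carries `δ ^ 2`. -/
theorem error_factor_le (m m' : ℕ) {α δ y : ℝ} (hα : 0 ≤ α) (hy : 0 ≤ y) :
    ((m + m' : ℕ) * (α * δ)) ^ 2 + (m + m' : ℕ) * (α * δ) * (m ^ 2 + m' ^ 2) * (δ * y) +
      (m ^ 3 + m' ^ 3) * (δ * y) ^ 2 ≤
      δ ^ 2 * (8 ^ (m + m') * (α ^ 2 + α * y + y ^ 2)) := by
  obtain ⟨h2, h3⟩ := pow_le_eight_pow (m + m')
  have hm : (0 : ℝ) ≤ m := Nat.cast_nonneg m
  have hm' : (0 : ℝ) ≤ m' := Nat.cast_nonneg m'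
  push_cast at h2 h3 ⊢
  have h4 : ((m : ℝ) + m') * (m ^ 2 + m' ^ 2) ≤ 8 ^ (m + m') := by
    refine le_trans ?_ h3
    nlinarith [mul_nonneg (mul_nonneg hm hm') (add_nonneg hm hm')]
  have h5 : (m : ℝ) ^ 3 + m' ^ 3 ≤ 8 ^ (m + m') := by
    refine le_trans ?_ h3
    nlinarith [mul_nonneg (mul_nonneg hm hm') (add_nonneg hm hm')]
  have hαy : 0 ≤ α * y := mul_nonneg hα hy
  calc _ = δ ^ 2 * (((m : ℝ) + m') ^ 2 * α ^ 2 + (((m : ℝ) + m') * (m ^ 2 + m' ^ 2)) * (α * y) +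
        (m ^ 3 + m' ^ 3) * y ^ 2) := by ring
    _ ≤ δ ^ 2 * (8 ^ (m + m') * α ^ 2 + 8 ^ (m + m') * (α * y) + 8 ^ (m + m') * y ^ 2) := by
        gcongr
    _ = _ := by ring

variable {Hs Ws ρ₀ : E →L[ℂ] E} {B : ℝ → ℝ → ℂ} {b b' b'' : ℝ}

theorem norm_schemeTerm_sub_le (hH : IsSelfAdjoint Hs) (hB : BathBounds B b b' b'') {n : ℕ} {δ : ℝ}
    (hδ : 0 < δ) (p : ℕ × ℕ) {α : ℝ} (hα : α = 1 + 2 * b' + 6 * b'' + 4 * ‖Hs‖) :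
    ‖schemeTerm Hs Ws ρ₀ B δ n p -
      ∫ s in simplex p.1 (n * δ) ×ˢ simplex p.2 (n * δ), kernel Hs Ws ρ₀ B s.1 s.2‖ ≤
      δ ^ 2 * (‖ρ₀‖ * (α ^ 2 + α * (n * δ)⁻¹ + (n * δ)⁻¹ ^ 2)) *
        majorant (8 * (n * δ * ((1 + b) * ‖Ws‖))) p := by
  obtain ⟨m, m'⟩ := p
  have h0 := hB.nonneg
  have h1 := hB.nonneg'
  have h2 := hB.nonneg''
  have hα0 : 0 ≤ α := by rw [hα]; positivity
  have key := norm_integral_simplex_sub_le (m := m) (m' := m') (n := n) hδ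
    (f := fun s => kernel Hs Ws ρ₀ B s.1 s.2)
    (M := (pairings (m + m')).card * (‖ρ₀‖ * ((1 + b) * ‖Ws‖) ^ (m + m')))
    (d := (m + m' : ℕ) * (α * δ)) (by positivity) (by positivity)
    (fun h h' => hα ▸ kernel_secondDiffBound hH hB hδ.le h h') (integrableOn_kernel hH hB m m' _)
  refine key.trans ?_
  -- For `n = 0` both sides are `0`.
  have hn : (1 : ℝ) / n = δ * (n * δ)⁻¹ := by
    rw [mul_inv, mul_comm (n : ℝ)⁻¹, ← mul_assoc, mul_inv_cancel₀ hδ.ne', one_mul, one_div]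
  have hfac := error_factor_le m m' (δ := δ) hα0 (inv_nonneg.2 (show (0 : ℝ) ≤ n * δ by positivity))
  rw [← hn] at hfac
  calc _ = (n * δ) ^ (m + m') / (m.factorial * m'.factorial) *
        ((pairings (m + m')).card * (‖ρ₀‖ * ((1 + b) * ‖Ws‖) ^ (m + m'))) *
        (((m + m' : ℕ) * (α * δ)) ^ 2 + (m + m' : ℕ) * (α * δ) * (m ^ 2 + m' ^ 2) * (1 / n) +
          (m ^ 3 + m' ^ 3) * (1 / n) ^ 2) := by
        rw [mul_one_div, one_div, inv_pow, ← div_eq_mul_inv]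
    _ ≤ (n * δ) ^ (m + m') / (m.factorial * m'.factorial) *
        ((pairings (m + m')).card * (‖ρ₀‖ * ((1 + b) * ‖Ws‖) ^ (m + m'))) *
        (δ ^ 2 * (8 ^ (m + m') * (α ^ 2 + α * (n * δ)⁻¹ + (n * δ)⁻¹ ^ 2))) :=
        mul_le_mul_of_nonneg_left hfac (by positivity)
    _ = _ := by
        rw [majorant, mul_pow 8, mul_pow (n * δ)]
        ring

theorem norm_dysonTerm_le (hH : IsSelfAdjoint Hs) (hW : IsSelfAdjoint Ws)
    (hB : BathBounds B b b' b'') {T : ℝ} (hT : 0 ≤ T) (p : ℕ × ℕ) :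
    ‖dysonTerm Hs Ws ρ₀ B T p‖ ≤ ‖ρ₀‖ * majorant (T * ((1 + b) * ‖Ws‖)) p := by
  rw [dysonTerm_eq hH hW hB]
  refine (norm_conj_freeProp_le hH _ _).trans ((norm_integral_simplex_le hT
    (integrableOn_kernel hH hB p.1 p.2 T) fun s => norm_kernel_le hH hB s.1 s.2).trans
    (le_of_eq ?_))
  rw [majorant, mul_pow T]
  ring

theorem summable_dysonTerm (hH : IsSelfAdjoint Hs) (hW : IsSelfAdjoint Ws)
    (hB : BathBounds B b b' b'') {T : ℝ} (hT : 0 ≤ T) :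
    Summable (dysonTerm Hs Ws ρ₀ B T) := by
  have h0 := hB.nonneg
  exact Summable.of_norm_bounded ((summable_majorant (by positivity)).mul_left _)
    (norm_dysonTerm_le hH hW hB hT)

/-- The scheme is read as a series with finitely many nonzero terms, so the comparison is term by
term; orders beyond the reach of the scheme are covered by the same estimate. -/
theorem norm_secondOrderScheme_sub_le (hH : IsSelfAdjoint Hs) (hW : IsSelfAdjoint Ws)
    (hB : BathBounds B b b' b'') {n : ℕ} {δ : ℝ} (hδ : 0 < δ) {α : ℝ}
    (hα : α = 1 + 2 * b' + 6 * b'' + 4 * ‖Hs‖) :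
    ‖secondOrderScheme Hs Ws ρ₀ B δ n - reducedDensity Hs Ws ρ₀ B (n * δ)‖ ≤
      δ ^ 2 * (‖ρ₀‖ * (α ^ 2 + α * (n * δ)⁻¹ + (n * δ)⁻¹ ^ 2)) *
        ∑' p, majorant (8 * (n * δ * ((1 + b) * ‖Ws‖))) p := by
  have h0 := hB.nonneg
  have hT : (0 : ℝ) ≤ n * δ := by positivity
  have hs := (summable_dysonTerm (ρ₀ := ρ₀) hH hW hB hT).hasSum
  have hfin : HasSum (fun p => freeProp Hs (n * δ) * schemeTerm Hs Ws ρ₀ B δ n p *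
      freeProp Hs (-(n * δ))) (secondOrderScheme Hs Ws ρ₀ B δ n) := by
    rw [secondOrderScheme_eq_sum hH]
    exact ((hasSum_sum_of_ne_finset_zero fun p hp =>
      schemeTerm_eq_zero Hs Ws ρ₀ B δ n hp).mul_left _).mul_right _
  have hm : Summable (majorant (8 * (n * δ * ((1 + b) * ‖Ws‖)))) :=
    summable_majorant (by positivity)
  refine (hfin.sub hs).norm_le_of_bounded (hm.hasSum.mul_left _) fun p => ?_
  rw [dysonTerm_eq hH hW hB, ← sub_mul, ← mul_sub]
  exact (norm_conj_freeProp_le hH _ _).trans (norm_schemeTerm_sub_le hH hB hδ p hα)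

end Final

end OpenSystem

theorem mainTheorem3 (r w h b b' b'' T : ℝ) :
    ∃ C : ℝ, ∀ (E : Type*) [NormedAddCommGroup E] [InnerProductSpace ℂ E] [CompleteSpace E]
      (Hs Ws ρ₀ : E →L[ℂ] E) (B : ℝ → ℝ → ℂ),
      IsSelfAdjoint Hs → IsSelfAdjoint Ws →
      ‖ρ₀‖ = r → ‖Ws‖ = w → ‖Hs‖ = h → OpenSystem.BathBounds B b b' b'' →
      ∀ (n : ℕ) (δ : ℝ), 0 < δ → n * δ = T →
        (∀ m m' : ℕ, MeasureTheory.IntegrableOn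
            (OpenSystem.dysonIntegrand Hs Ws ρ₀ B (n * δ) m m')
            (OpenSystem.simplex m (n * δ) ×ˢ OpenSystem.simplex m' (n * δ))) ∧
        Summable (OpenSystem.dysonTerm Hs Ws ρ₀ B (n * δ)) ∧
        ‖OpenSystem.secondOrderScheme Hs Ws ρ₀ B δ n -
            OpenSystem.reducedDensity Hs Ws ρ₀ B (n * δ)‖ ≤ C * δ ^ 2 := by
  set α : ℝ := 1 + 2 * b' + 6 * b'' + 4 * h with hα
  refine ⟨r * (α ^ 2 + α * T⁻¹ + T⁻¹ ^ 2) *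
    ∑' p, OpenSystem.majorant (8 * (T * ((1 + b) * w))) p, ?_⟩
  intro E _ _ _ Hs Ws ρ₀ B hH hW hr hw hh hB n δ hδ hT
  refine ⟨fun m m' => OpenSystem.integrableOn_dysonIntegrand hH hW hB m m' _,
    OpenSystem.summable_dysonTerm hH hW hB (by positivity), ?_⟩
  have key := OpenSystem.norm_secondOrderScheme_sub_le (ρ₀ := ρ₀) hH hW hB (n := n) hδ
    (hα.trans (by rw [hh]))
  rw [hr, hw, hT] at key
  rw [hT]
  exact key.trans (le_of_eq (by ring))
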